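/- For a finite simple graph $G$, an integer $k\ge 0$ and a set $S\subseteq V(G)$ let $\mathrm{CDS}(G,k,S)=\min\{|S|,k+1\}$ if $S$ is a connected dominating set of $G$ (that is, $G[S]$ is connected and nonempty and every vertex lies in $S$ or has a neighbour in $S$), and $\mathrm{CDS}(G,k,S)=\infty$ otherwise. Let $\mathrm{OPT}(G,k)=\min_{S\subseteq V(G)}\mathrm{CDS}(G,k,S)$. For $\alpha>1$, an \emph{$\alpha$-approximate kernel} for \textsc{Connected Dominating Set}, parameterized by solution size, on a class $\mathcal C$ of graphs consists of two algorithms that run in polynomial time (in the sizes of the graphs and the parameters): a reduction algorithm, which maps every instance $(G,k)$ with $G\in\mathcal C$ to an instance $(G',k')$ with $G'\in\mathcal C$, and a solution lifting algorithm, which maps $(G,k)$, $(G',k')$ and a set $S'\subseteq V(G')$ to a set $S\subseteq V(G)$ such that $$\frac{\mathrm{CDS}(G,k,S)}{\mathrm{OPT}(G,k)}\le\alpha\cdot\frac{\mathrm{CDS}(G',k',S')}{\mathrm{OPT}(G',k')},$$ where quotients are taken in $[0,\infty]$ with $v/\infty=0$; moreover the size of $(G',k')$ has to be bounded by a function of $k$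 alone. \textbf{Theorem 2.} There is a constant $C$ such that for every integer $d\ge 1$ and every $\varepsilon>0$, \textsc{Connected Dominating Set}, parameterized by solution size, has a $(1+\varepsilon)$-approximate kernel on the class of graphs that do not contain $K_{d,d}$ as a subgraph, whose reduced instances $(G',k')$ satisfy $|V(G')|\le k^{C d^2/\min\{\varepsilon,1\}}$ and $k'\le k^{C d^2/\min\{\varepsilon,1\}}$ (for $k=0$, read the bounds with $k=1$). In particular, for every $d\ge1$ the problem has a polynomial-size approximate kernelization scheme (PSAKS) on this class: there are functions $f,g$ such that for every $\alpha>1$ it has an $\alpha$-approximate kernel in which the total size of $(G',k')$ is at most $f(\alpha)\,k^{g(\alpha)}$ (again with $k=1$ in place of $k=0$). -/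

import Mathlib

open scoped ENNReal

namespace LossyKernel

/-! ## Polynomial-time computation

The machine model is the WHILE language: the data are finite binary trees, the primitive operations
are the constant `nil`, pairing and the two projections, and the control structures are composition,
conditional and while loop.  Every executed construct is charged one unit plus the sizes of its input
and its output (in addition to the costs of the executions of its parts), so that a cost unit is a
constant number of steps of a multi-tape Turing machine, no data can be built or copied for free, and
"polynomial cost" is "polynomial time". -/

/-- Finite binary trees, the data on which programs work. -/
inductive Data : Type
  | nil : Data
  | node (left right : Data) : Data

namespace Data

/-- The number of (inner and outer) nodes of a tree. -/
def size : Data → ℕ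
  | nil => 1
  | node l r => l.size + r.size + 1

/-- Left component (`nil` has `nil` as components). -/
def fst : Data → Data
  | nil => nil
  | node l _ => l

/-- Right component. -/
def snd : Data → Data
  | nil => nil
  | node _ r => r

/-- A truth value: `nil` is false, everything else is true. -/
def ofBool : Bool → Data
  | false => nil
  | true => node nil nil

/-- The list `[a₁, …, aₘ]` as the tree `(a₁, (a₂, … (aₘ, nil)))`. -/
def ofList : List Data → Data
  | [] => nil
  | a :: l => node a (ofList l)

/-- A natural number in unary. -/
def ofNat : ℕ → Data
  | 0 => nil
  | m + 1 => node nil (ofNat m)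

end Data

/-- Programs of the WHILE language, in the form with a single variable `x`, which holds the input. -/
inductive Prog : Type
  /-- `x` -/
  | id : Prog
  /-- the constant `nil` -/
  | nil : Prog
  /-- the left component of `x` -/
  | fst : Prog
  /-- the right component of `x` -/
  | snd : Prog
  /-- the pair of the results of `p` and `q`, both run on `x` -/
  | pair (p q : Prog) : Prog
  /-- run `p` on `x`, then `q` on the result -/
  | seq (p q : Prog) : Prog
  /-- if the result of `c` on `x` is true (not `nil`) then run `p` on `x`, else run `q` on `x` -/
  | ite (c p q : Prog) : Prog
  /-- while the result of `c` on `x` is true (not `nil`), replace `x` by the result of `p` on `x` -/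
  | loop (c p : Prog) : Prog

/-- `p.Eval x y t`: started on input `x`, the program `p` halts with output `y` and total cost `t`. -/
inductive Prog.Eval : Prog → Data → Data → ℕ → Prop
  | id (x : Data) : Eval .id x x (1 + x.size + x.size)
  | nil (x : Data) : Eval .nil x .nil (1 + x.size + Data.nil.size)
  | fst (x : Data) : Eval .fst x x.fst (1 + x.size + x.fst.size)
  | snd (x : Data) : Eval .snd x x.snd (1 + x.size + x.snd.size)
  | pair {p q : Prog} {x y z : Data} {s t : ℕ} (hp : Eval p x y s) (hq : Eval q x z t) :
      Eval (.pair p q) x (.node y z) (s + t + (1 + x.size + (Data.node y z).size))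
  | seq {p q : Prog} {x y z : Data} {s t : ℕ} (hp : Eval p x y s) (hq : Eval q y z t) :
      Eval (.seq p q) x z (s + t + (1 + x.size + z.size))
  | ite_true {c p q : Prog} {x u v y : Data} {s t : ℕ} (hc : Eval c x (.node u v) s)
      (hp : Eval p x y t) : Eval (.ite c p q) x y (s + t + (1 + x.size + y.size))
  | ite_false {c p q : Prog} {x y : Data} {s t : ℕ} (hc : Eval c x .nil s)
      (hq : Eval q x y t) : Eval (.ite c p q) x y (s + t + (1 + x.size + y.size))
  | loop_stop {c p : Prog} {x : Data} {s : ℕ} (hc : Eval c x .nil s) :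
      Eval (.loop c p) x x (s + (1 + x.size + x.size))
  | loop_step {c p : Prog} {x u v y z : Data} {s t r : ℕ} (hc : Eval c x (.node u v) s)
      (hp : Eval p x y t) (hl : Eval (.loop c p) y z r) :
      Eval (.loop c p) x z (s + t + r + (1 + x.size + z.size))

/-- The task with instances `i : ι`, which are given as `inp i` and have to be answered by `out i`,
is solved by one program whose cost is bounded by a polynomial in the size of its input. -/
def PolyTimeComputable {ι : Type} (inp out : ι → Data) : Prop :=
  ∃ (p : Prog) (P : Polynomial ℕ), ∀ i, ∃ t, t ≤ P.eval (inp i).size ∧ p.Eval (inp i) (out i) t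

/-! ## Vertex-subset problems as parameterized minimization problems -/

/-- An instance `(G, k)`: a finite simple graph, with vertices numbered `0, …, n - 1`, and a
parameter. -/
structure Instance : Type where
  n : ℕ
  graph : SimpleGraph (Fin n)
  k : ℕ

/-- A class of finite graphs. -/
abbrev GraphClass : Type := (n : ℕ) → SimpleGraph (Fin n) → Prop

/-- The instances whose graph belongs to the class `𝒞`. -/
abbrev InstanceOn (𝒞 : GraphClass) : Type := {I : Instance // 𝒞 I.n I.graph}

/-- A vertex-subset problem: which sets of vertices are feasible solutions for a graph. -/
abbrev VertexSubsetProblem : Type := (n : ℕ) → SimpleGraph (Fin n) → Finset (Fin n) → Prop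

open Classical in
/-- A set of vertices as the list of its membership bits. -/
noncomputable def encodeSet {n : ℕ} (S : Finset (Fin n)) : Data :=
  .ofList (List.ofFn fun i : Fin n => .ofBool (decide (i ∈ S)))

open Classical in
/-- An instance as the pair of its adjacency matrix (the list of its rows) and its parameter, in
unary, so that the size of the code is polynomially related to the size of the graph plus `k`. -/
noncomputable def Instance.encode (I : Instance) : Data :=
  .node
    (.ofList (List.ofFn fun i : Fin I.n =>
      .ofList (List.ofFn fun j : Fin I.n => .ofBool (decide (I.graph.Adj i j)))))
    (.ofNat I.k)

open Classical in
/-- The value `𝒬(G, k, S)`: `∞` if `S` is not feasible, and `min {|S|, k + 1}` otherwise. -/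
noncomputable def value (𝒬 : VertexSubsetProblem) (I : Instance) (S : Finset (Fin I.n)) : ℝ≥0∞ :=
  if 𝒬 I.n I.graph S then ((min S.card (I.k + 1) : ℕ) : ℝ≥0∞) else ∞

/-- The optimum value `OPT(G, k)`. -/
noncomputable def opt (𝒬 : VertexSubsetProblem) (I : Instance) : ℝ≥0∞ :=
  ⨅ S : Finset (Fin I.n), value 𝒬 I S

/-! ## Approximate kernels -/

/-- An `α`-approximate polynomial-time pre-processing algorithm for the problem `𝒬` on the graph
class `𝒞`: a polynomial-time reduction algorithm, which maps instances on `𝒞` to instances on `𝒞`, and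
a polynomial-time solution lifting algorithm, which is given an instance, the reduced instance and a
solution of the latter, and returns a solution of the former.  The quotients are those of `[0, ∞]`:
as `v / ∞ = 0`, nothing is asked for an instance that has no feasible solution, and an instance with
`0 < OPT < ∞` may not be reduced to one without a feasible solution. -/
structure ApproxPreprocessing (𝒬 : VertexSubsetProblem) (𝒞 : GraphClass) (α : ℝ) : Type where
  reduce : InstanceOn 𝒞 → InstanceOn 𝒞
  lift : (I : InstanceOn 𝒞) → Finset (Fin (reduce I).1.n) → Finset (Fin I.1.n)
  reduce_polyTime : PolyTimeComputable
    (fun I : InstanceOn 𝒞 => I.1.encode)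
    (fun I => (reduce I).1.encode)
  lift_polyTime : PolyTimeComputable
    (fun i : (I : InstanceOn 𝒞) × Finset (Fin (reduce I).1.n) =>
      .node i.1.1.encode (.node (reduce i.1).1.encode (encodeSet i.2)))
    (fun i => encodeSet (lift i.1 i.2))
  ratio_le : ∀ (I : InstanceOn 𝒞) (S : Finset (Fin (reduce I).1.n)),
    value 𝒬 I.1 (lift I S) / opt 𝒬 I.1 ≤
      ENNReal.ofReal α * (value 𝒬 (reduce I).1 S / opt 𝒬 (reduce I).1)

/-- `𝒬` on `𝒞` has an `α`-approximate kernel with at most `b k` vertices (and new parameter at most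
`b k`), where `k` is the parameter of the given instance. -/
def HasApproxKernelWithVertices (𝒬 : VertexSubsetProblem) (𝒞 : GraphClass) (α : ℝ) (b : ℕ → ℝ) :
    Prop :=
  ∃ A : ApproxPreprocessing 𝒬 𝒞 α, ∀ I : InstanceOn 𝒞,
    ((A.reduce I).1.n : ℝ) ≤ b I.1.k ∧ ((A.reduce I).1.k : ℝ) ≤ b I.1.k

/-- `𝒬` on `𝒞` has a polynomial-size approximate kernelization scheme: for every `α > 1` an
`α`-approximate kernel whose total size is at most `f(α) * k ^ g(α)` (for `k = 0`, which such a bound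
is not meant to cover, the same as for `k = 1`). -/
def HasPSAKS (𝒬 : VertexSubsetProblem) (𝒞 : GraphClass) : Prop :=
  ∃ f g : ℝ → ℝ, ∀ α : ℝ, 1 < α → ∃ A : ApproxPreprocessing 𝒬 𝒞 α, ∀ I : InstanceOn 𝒞,
    ((A.reduce I).1.encode.size : ℝ) ≤ f α * ((max I.1.k 1 : ℕ) : ℝ) ^ g α

/-! ## Connected Dominating Set on biclique-free graphs -/

/-- Connected Dominating Set: `S` induces a connected (in particular nonempty) subgraph, and every
vertex belongs to `S` or has a neighbour in `S`. -/
def connectedDominatingSet : VertexSubsetProblem := fun _ G S =>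
  (G.induce (S : Set _)).Connected ∧ ∀ v, v ∈ S ∨ ∃ u ∈ S, G.Adj v u

/-- The graphs that do not contain `K_{d,d}` as a (not necessarily induced) subgraph. -/
def bicliqueFree (d : ℕ) : GraphClass := fun _ G =>
  (completeBipartiteGraph (Fin d) (Fin d)).Free G

end LossyKernel

/-!
The kernel of an instance `(G, k)` is an induced subgraph of `G` with the same parameter `k`.

*Domination core.* If a set `Z` of vertices has more than `2 * d * r ^ d` elements, then one can pass
greedily to parts of `Z` that lie in the closed neighbourhood of one more vertex and lose a factor of at
most `r` each time.  As there is no `K_{d,d}`, this stops at a set `W` before `d` vertices are used: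
no further vertex covers the fraction `1 / r` of `W`, so a set of less than `r` vertices that dominates
all but one of the vertices of `W` contains one of the vertices used, and it dominates the last one too
(`concentrate_spec`, `exists_near_headD_concentrate`).  Deleting such vertices as long as there are too
many leaves a core of `k ^ O(d)` vertices: every set of at most `2 * k` vertices that dominates the core
dominates `G` (`core_spec`).

*Pieces.* A connected set `D` is the union of `m + 1` connected pieces of size at most `2 * s`, where
`m ≤ |D| / s` and the pieces have `|D| + m` elements together (`Conn.exists_pieces`).  Every piece may be
replaced by any other connected set that is not larger and dominates the same vertices of the core, so
one representative for every possible trace on the core is enough.  Without a `K_{d,d}` the core has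
only `k ^ O(d²)` traces of closed neighbourhoods (`card_traces_le`), hence there are `k ^ O(d² * s)`
representatives.

*Links.* The representatives of the pieces of a solution `D` dominate `G`, but they are no longer
connected to each other.  If walks of length at most three between all pairs of vertices kept so far are
added, then the kernel is connected (`conn_of_links`), and within a connected graph `m + 1` connected
sets which dominate it together are joined by `2 * m` further vertices (`exists_conn_of_dominating`).
Hence the optimum of the kernel is at most `(1 + 3 / s) * |D|` (`opt_kernel_le_mul`).  Conversely, a
connected dominating set of at most `k` vertices of the kernel dominates the core, so it is one of `G`
(`value_liftSolution_le`).

*Polynomial time.* Everything is computed by folds over lists whose intermediate results are small.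
`PolyTime` is closed under the usual operations on lists and numbers, and these closure properties are
registered with `fun_prop`, so that the algorithms are seen to be polynomial from the shape of their
definitions.
-/

namespace LossyKernel
/-! ### Closure properties of polynomial-time computation -/

theorem Prog.Eval.size_le {p : Prog} {x y : Data} {t : ℕ} (h : p.Eval x y t) : y.size ≤ t := by
  cases h <;> omega

theorem Data.size_fst_le (x : Data) : x.fst.size ≤ x.size := by
  cases x <;> simp [Data.size, Data.fst]; omega

theorem Data.size_snd_le (x : Data) : x.snd.size ≤ x.size := by
  cases x <;> simp [Data.size, Data.snd]; omega

theorem eval_mono (P : Polynomial ℕ) {m n : ℕ} (h : m ≤ n) : P.eval m ≤ P.eval n := by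
  rw [Polynomial.eval_eq_sum_range, Polynomial.eval_eq_sum_range]
  gcongr

namespace PolyTimeComputable

variable {ι κ : Type} {inp mid out out' : ι → Data}

theorem reindex (h : PolyTimeComputable inp out) (f : κ → ι) :
    PolyTimeComputable (fun j => inp (f j)) (fun j => out (f j)) := by
  obtain ⟨p, P, h⟩ := h
  exact ⟨p, P, fun j => h (f j)⟩

theorem size_le (h : PolyTimeComputable inp out) :
    ∃ P : Polynomial ℕ, ∀ i, (out i).size ≤ P.eval (inp i).size := by
  obtain ⟨p, P, h⟩ := h
  refine ⟨P, fun i => ?_⟩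
  obtain ⟨t, ht, e⟩ := h i
  exact e.size_le.trans ht

theorem refl : PolyTimeComputable inp inp :=
  ⟨.id, 1 + 2 * .X, fun i => ⟨_, by simp; omega, .id _⟩⟩

theorem fst : PolyTimeComputable inp fun i => (inp i).fst :=
  ⟨.fst, 1 + 2 * .X, fun i => ⟨_, by have := (inp i).size_fst_le; simp; omega, .fst _⟩⟩

theorem snd : PolyTimeComputable inp fun i => (inp i).snd :=
  ⟨.snd, 1 + 2 * .X, fun i => ⟨_, by have := (inp i).size_snd_le; simp; omega, .snd _⟩⟩

theorem comp (h₁ : PolyTimeComputable inp mid) (h₂ : PolyTimeComputable mid out) :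
    PolyTimeComputable inp out := by
  obtain ⟨p, P, h₁⟩ := h₁
  obtain ⟨q, Q, h₂⟩ := h₂
  refine ⟨.seq p q, P + Q.comp P + (1 + .X + Q.comp P), fun i => ?_⟩
  obtain ⟨s, hs, e₁⟩ := h₁ i
  obtain ⟨t, ht, e₂⟩ := h₂ i
  have hQ := eval_mono Q (e₁.size_le.trans hs)
  have := e₂.size_le
  refine ⟨_, ?_, .seq e₁ e₂⟩
  simp only [Polynomial.eval_add, Polynomial.eval_comp, Polynomial.eval_one, Polynomial.eval_X]
  omega

theorem pair (h₁ : PolyTimeComputable inp out) (h₂ : PolyTimeComputable inp out') :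
    PolyTimeComputable inp fun i => .node (out i) (out' i) := by
  obtain ⟨p, P, h₁⟩ := h₁
  obtain ⟨q, Q, h₂⟩ := h₂
  refine ⟨.pair p q, P + Q + (1 + .X + (P + Q + 1)), fun i => ?_⟩
  obtain ⟨s, hs, e₁⟩ := h₁ i
  obtain ⟨t, ht, e₂⟩ := h₂ i
  have := e₁.size_le
  have := e₂.size_le
  refine ⟨_, ?_, .pair e₁ e₂⟩
  simp only [Polynomial.eval_add, Polynomial.eval_one, Polynomial.eval_X, Data.size]
  omega

theorem const (x : Data) : PolyTimeComputable inp fun _ => x := by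
  induction x with
  | nil => exact ⟨.nil, 2 + .X, fun i => ⟨_, by
      simp only [Data.size, Polynomial.eval_add, Polynomial.eval_X, Polynomial.eval_ofNat]
      omega, .nil _⟩⟩
  | node l r hl hr => exact hl.pair hr

theorem cond {tst res : ι → Data} (hc : PolyTimeComputable inp tst)
    (h₁ : PolyTimeComputable inp out) (h₂ : PolyTimeComputable inp out')
    (hr₁ : ∀ i, tst i ≠ .nil → res i = out i) (hr₂ : ∀ i, tst i = .nil → res i = out' i) :
    PolyTimeComputable inp res := by
  obtain ⟨r, R, hc⟩ := hc
  obtain ⟨p, P, h₁⟩ := h₁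
  obtain ⟨q, Q, h₂⟩ := h₂
  refine ⟨.ite r p q, R + P + Q + (1 + .X + P + Q), fun i => ?_⟩
  obtain ⟨u, hu, e⟩ := hc i
  obtain ⟨s, hs, e₁⟩ := h₁ i
  obtain ⟨t, ht, e₂⟩ := h₂ i
  have := e₁.size_le
  have := e₂.size_le
  simp only [Polynomial.eval_add, Polynomial.eval_one, Polynomial.eval_X]
  cases hi : tst i with
  | nil =>
    rw [hi] at e
    rw [hr₂ i hi]
    exact ⟨_, by omega, .ite_false e e₂⟩
  | node a b =>
    rw [hi] at e
    rw [hr₁ i (by simp [hi])]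
    exact ⟨_, by omega, .ite_true e e₁⟩

end PolyTimeComputable

/-- A way to write the elements of a type as trees.  Injectivity is not required, as programs are only
compared with functions between encoded types. -/
class Enc (α : Type) where
  enc : α → Data

open Enc (enc)

/-- The size of the code of an element. -/
def esize {α : Type} [Enc α] (a : α) : ℕ := (enc a).size

instance : Enc Data := ⟨id⟩
instance : Enc Bool := ⟨Data.ofBool⟩
instance : Enc ℕ := ⟨Data.ofNat⟩
instance {α β : Type} [Enc α] [Enc β] : Enc (α × β) := ⟨fun x => .node (enc x.1) (enc x.2)⟩
instance {α : Type} [Enc α] : Enc (List α) := ⟨fun l => .ofList (l.map enc)⟩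

section esize

variable {α β : Type} [Enc α] [Enc β]

@[simp] theorem esize_pair (a : α) (b : β) : esize (a, b) = esize a + esize b + 1 := rfl

@[simp] theorem esize_nil : esize ([] : List α) = 1 := rfl

@[simp] theorem esize_cons (a : α) (l : List α) : esize (a :: l) = esize a + esize l + 1 := rfl

@[simp] theorem esize_nat (n : ℕ) : esize n = 2 * n + 1 := by
  induction n with
  | zero => rfl
  | succ n ih =>
    have : esize (n + 1) = 1 + esize n + 1 := rfl
    omega

theorem esize_bool_le (b : Bool) : esize b ≤ 3 := by
  cases b <;> simp [esize, enc, Data.ofBool, Data.size]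

theorem esize_append (l₁ l₂ : List α) : esize (l₁ ++ l₂) + 1 = esize l₁ + esize l₂ := by
  induction l₁ with
  | nil => simp; omega
  | cons a l ih => simp only [List.cons_append, esize_cons]; omega

theorem esize_le_of_sublist {l₁ l₂ : List α} (h : l₁.Sublist l₂) : esize l₁ ≤ esize l₂ := by
  induction h with
  | slnil => rfl
  | cons a _ ih => simp; omega
  | cons_cons a _ ih => simp; omega

theorem length_le_esize (l : List α) : l.length ≤ esize l := by
  induction l with
  | nil => simp
  | cons a l ih => simp; omega

theorem esize_le_of_mem {l : List α} {a : α} (h : a ∈ l) : esize a ≤ esize l := by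
  induction l with
  | nil => simp at h
  | cons b l ih =>
    rcases List.mem_cons.1 h with rfl | h
    · simp; omega
    · have := ih h; simp; omega

end esize

/-- A function between encoded types that is computed by a program in polynomial time. -/
@[fun_prop]
def PolyTime {α β : Type} [Enc α] [Enc β] (f : α → β) : Prop :=
  PolyTimeComputable (fun a => enc a) (fun a => enc (f a))

namespace PolyTime

variable {α β γ δ : Type} [Enc α] [Enc β] [Enc γ] [Enc δ]

@[fun_prop]
theorem id : PolyTime fun a : α => a := .refl

@[fun_prop]
theorem const (b : β) : PolyTime fun _ : α => b := PolyTimeComputable.const _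

@[fun_prop]
theorem comp {g : β → γ} {f : α → β} (hg : PolyTime g) (hf : PolyTime f) :
    PolyTime fun a => g (f a) := PolyTimeComputable.comp hf (hg.reindex f)

@[fun_prop]
theorem pair {f : α → β} {g : α → γ} (hf : PolyTime f) (hg : PolyTime g) :
    PolyTime fun a => (f a, g a) := PolyTimeComputable.pair hf hg

@[fun_prop]
theorem fst : PolyTime (Prod.fst : α × β → α) :=
  PolyTimeComputable.fst (inp := fun a : α × β => enc a)

@[fun_prop]
theorem snd : PolyTime (Prod.snd : α × β → β) :=
  PolyTimeComputable.snd (inp := fun a : α × β => enc a)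

theorem esize_le {f : α → β} (hf : PolyTime f) :
    ∃ P : Polynomial ℕ, ∀ a, esize (f a) ≤ P.eval (esize a) := PolyTimeComputable.size_le hf

@[fun_prop]
theorem cond {c : α → Bool} {f g : α → β} (hc : PolyTime c) (hf : PolyTime f) (hg : PolyTime g) :
    PolyTime fun a => bif c a then f a else g a := by
  refine PolyTimeComputable.cond hc hf hg (fun a h => ?_) (fun a h => ?_) <;> dsimp only <;>
    cases hc : c a
  · simp [hc, enc, Data.ofBool] at h
  · rfl
  · rfl
  · simp [hc, enc, Data.ofBool] at h

/-- Every function on truth values is computed in constant time. -/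
theorem of_bool (f : Bool → α) : PolyTime f := by
  have : PolyTime fun b : Bool => bif b then f true else f false := by fun_prop
  convert this using 2 with b
  cases b <;> rfl

@[fun_prop]
theorem not {f : α → Bool} (hf : PolyTime f) : PolyTime fun a => !(f a) :=
  (of_bool Bool.not).comp hf

@[fun_prop]
theorem and {f g : α → Bool} (hf : PolyTime f) (hg : PolyTime g) :
    PolyTime fun a => f a && g a := by
  have : PolyTime fun a => bif f a then g a else false := by fun_prop
  convert this using 2 with b
  cases f b <;> rfl

@[fun_prop]
theorem or {f g : α → Bool} (hf : PolyTime f) (hg : PolyTime g) :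
    PolyTime fun a => f a || g a := by
  have : PolyTime fun a => bif f a then true else g a := by fun_prop
  convert this using 2 with b
  cases f b <;> rfl

@[fun_prop]
theorem cons {f : α → β} {g : α → List β} (hf : PolyTime f) (hg : PolyTime g) :
    PolyTime fun a => f a :: g a := PolyTimeComputable.pair hf hg

@[fun_prop]
theorem succ {f : α → ℕ} (hf : PolyTime f) : PolyTime fun a => f a + 1 :=
  PolyTimeComputable.pair (.const .nil) hf

@[fun_prop]
theorem pred {f : α → ℕ} (hf : PolyTime f) : PolyTime fun a => f a - 1 := by
  have : PolyTime Nat.pred := by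
    unfold PolyTime
    convert PolyTimeComputable.snd (inp := fun n : ℕ => enc n) using 2 with n
    cases n <;> rfl
  exact this.comp hf

@[fun_prop]
theorem tail {f : α → List β} (hf : PolyTime f) : PolyTime fun a => (f a).tail := by
  have : PolyTime fun l : List β => l.tail := by
    unfold PolyTime
    convert PolyTimeComputable.snd (inp := fun n : List β => enc n) using 2 with n
    cases n <;> rfl
  exact this.comp hf

/-- The head of a list, where the default value has to be the element that is coded by `nil`. -/
theorem headD {f : α → List β} (hf : PolyTime f) {d : β} (hd : enc d = .nil) :
    PolyTime fun a => (f a).headD d := by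
  have : PolyTime fun l : List β => l.headD d := by
    unfold PolyTime
    convert PolyTimeComputable.fst (inp := fun n : List β => enc n) using 2 with n
    cases n
    · exact hd
    · rfl
  exact this.comp hf

@[fun_prop]
theorem isEmpty {f : α → List β} (hf : PolyTime f) : PolyTime fun a => (f a).isEmpty := by
  have : PolyTime fun l : List β => l.isEmpty := by
    refine PolyTimeComputable.cond .refl (.const (enc false)) (.const (enc true)) ?_ ?_ <;>
      rintro (_ | ⟨b, l⟩) h
    · simp [enc, Data.ofList] at h
    · rfl
    · rfl
    · simp [enc, Data.ofList] at h
  exact this.comp hf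

end PolyTime

/-! ### Folds, lists and arithmetic in polynomial time -/

/-- A loop that runs through a list, evaluated: if all states that occur have size at most `N`, and
test and body cost at most `T` on such states, then a round costs at most `2 * T + 1 + 2 * N`. -/
theorem Prog.Eval.foldl {γ α β : Type} [Enc γ] [Enc α] [Enc β] {f : γ → β → α → β} {p q : Prog}
    {T N : ℕ} {c : γ}
    (hp : ∀ (l : List α) (b : β), esize (c, l, b) ≤ N → ∃ t ≤ T, p.Eval (enc (c, l, b)) (enc l) t)
    (hq : ∀ (a : α) (l : List α) (b : β), esize (c, a :: l, b) ≤ N →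
      ∃ t ≤ T, q.Eval (enc (c, a :: l, b)) (enc (c, l, f c b a)) t)
    (l : List α) (b : β)
    (hN : ∀ l₁ l₂, l = l₁ ++ l₂ → esize (c, l₂, l₁.foldl (f c) b) ≤ N) :
    ∃ t ≤ (l.length + 1) * (2 * T + 1 + 2 * N),
      (Prog.loop p q).Eval (enc (c, l, b)) (enc (c, ([] : List α), l.foldl (f c) b)) t := by
  induction l generalizing b with
  | nil =>
    have h := hN [] [] rfl
    obtain ⟨t, ht, e⟩ := hp [] b h
    have e' : (Prog.loop p q).Eval (enc (c, ([] : List α), b)) (enc (c, ([] : List α), b))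
        (t + (1 + (enc (c, ([] : List α), b)).size + (enc (c, ([] : List α), b)).size)) := by
      constructor
      exact e
    refine ⟨_, ?_, e'⟩
    simp only [esize, List.foldl_nil] at h
    simp only [List.length_nil]
    omega
  | cons a l ih =>
    have h := hN [] (a :: l) rfl
    obtain ⟨s, hs, e₁⟩ := hp (a :: l) b h
    obtain ⟨t, ht, e₂⟩ := hq a l b h
    obtain ⟨r, hr, e₃⟩ := ih (f c b a) fun l₁ l₂ hl => hN (a :: l₁) l₂ (by rw [hl]; rfl)
    refine ⟨_, ?_, .loop_step e₁ e₂ e₃⟩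
    have h' := hN (a :: l) [] (by simp)
    simp only [esize, List.foldl_nil, List.foldl_cons] at h h' ⊢
    rw [List.length_cons, add_mul _ 1, one_mul]
    omega

namespace PolyTime

variable {α β γ δ ε : Type} [Enc α] [Enc β] [Enc γ] [Enc δ] [Enc ε]

/-- Folds are computed in polynomial time if the intermediate results are of polynomial size. -/
theorem foldl_of_bound {f : γ → β → α → β} {l : γ → List α} {b : γ → β}
    (hf : PolyTime fun x : γ × β × α => f x.1 x.2.1 x.2.2) (hl : PolyTime l) (hb : PolyTime b)
    {R : Polynomial ℕ}
    (hR : ∀ c l₁ l₂, l c = l₁ ++ l₂ → esize (l₁.foldl (f c) (b c)) ≤ R.eval (esize c)) :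
    PolyTime fun c => (l c).foldl (f c) (b c) := by
  have hstart : PolyTime fun c => (c, l c, b c) := by fun_prop
  have hbody : PolyTimeComputable (fun i : γ × α × List α × β => enc (i.1, i.2.1 :: i.2.2.1, i.2.2.2))
      (fun i => enc (i.1, i.2.2.1, f i.1 i.2.2.2 i.2.1)) := by
    refine PolyTimeComputable.comp (mid := fun i => enc i)
      (PolyTimeComputable.pair (.fst (inp := fun i : γ × α × List α × β =>
        enc (i.1, i.2.1 :: i.2.2.1, i.2.2.2))) ?_) ?_
    · have h := PolyTimeComputable.snd
        (inp := fun i : γ × α × List α × β => enc (i.1, i.2.1 :: i.2.2.1, i.2.2.2))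
      exact (h.comp (.comp .fst .fst)).pair ((h.comp (.comp .fst .snd)).pair (h.comp .snd))
    · have : PolyTime fun i : γ × α × List α × β => (i.1, i.2.2.1, f i.1 i.2.2.2 i.2.1) := by
        fun_prop
      exact this
  obtain ⟨q, Q, hq⟩ := hbody
  obtain ⟨p, P, hp⟩ : PolyTime fun i : γ × List α × β => i.2.1 := by fun_prop
  obtain ⟨S, hS⟩ := hl.esize_le
  have hloop : PolyTimeComputable (fun c => enc (c, l c, b c))
      (fun c => enc (c, ([] : List α), (l c).foldl (f c) (b c))) := by
    let N : Polynomial ℕ := .X + S + R + 2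
    let T : Polynomial ℕ := P.comp N + Q.comp N
    refine ⟨.loop p q, (S + 1) * (2 * T + 1 + 2 * N), fun c => ?_⟩
    have hN : ∀ l₁ l₂, l c = l₁ ++ l₂ →
        esize (c, l₂, l₁.foldl (f c) (b c)) ≤ N.eval (esize c) := by
      intro l₁ l₂ h
      have h1 := hR c l₁ l₂ h
      have h2 : esize l₂ ≤ esize (l c) :=
        esize_le_of_sublist (h ▸ List.sublist_append_right l₁ l₂)
      have h3 := hS c
      simp only [N, esize_pair, Polynomial.eval_add, Polynomial.eval_X, Polynomial.eval_ofNat]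
      omega
    have hp' : ∀ (l : List α) (b : β), esize (c, l, b) ≤ N.eval (esize c) →
        ∃ t ≤ T.eval (esize c), p.Eval (enc (c, l, b)) (enc l) t := by
      intro l b h
      obtain ⟨t, ht, e⟩ := hp (c, l, b)
      refine ⟨t, ht.trans ?_, e⟩
      have := eval_mono P h
      simp only [T, Polynomial.eval_add, Polynomial.eval_comp]
      exact this.trans (Nat.le_add_right _ _)
    have hq' : ∀ (a : α) (l : List α) (b : β), esize (c, a :: l, b) ≤ N.eval (esize c) →
        ∃ t ≤ T.eval (esize c), q.Eval (enc (c, a :: l, b)) (enc (c, l, f c b a)) t := by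
      intro a l b h
      obtain ⟨t, ht, e⟩ := hq (c, a, l, b)
      refine ⟨t, ht.trans ?_, e⟩
      have := eval_mono Q h
      simp only [T, Polynomial.eval_add, Polynomial.eval_comp]
      exact this.trans (Nat.le_add_left _ _)
    obtain ⟨t, ht, e⟩ := Prog.Eval.foldl hp' hq' (l c) (b c) hN
    refine ⟨t, ht.trans ?_, e⟩
    have h1 : esize c ≤ (enc (c, l c, b c)).size := by
      change esize c ≤ esize (c, l c, b c)
      simp; omega
    refine le_trans ?_ (eval_mono _ h1)
    simp only [Polynomial.eval_mul, Polynomial.eval_add, Polynomial.eval_one,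
      Polynomial.eval_ofNat]
    gcongr
    exact (length_le_esize _).trans (hS c)
  exact (PolyTimeComputable.comp hstart hloop).comp (.comp .snd .snd)

/-- Folds are computed in polynomial time if every step adds at most the size of something that is
computable from the context and the list element alone. -/
theorem foldl {f : γ → β → α → β} {l : γ → List α} {b : γ → β} {g : γ × α → δ}
    (hf : PolyTime fun x : γ × β × α => f x.1 x.2.1 x.2.2) (hl : PolyTime l) (hb : PolyTime b)
    (hg : PolyTime g) (h : ∀ c b a, esize (f c b a) ≤ esize b + esize (g (c, a))) :
    PolyTime fun c => (l c).foldl (f c) (b c) := by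
  obtain ⟨S, hS⟩ := hl.esize_le
  obtain ⟨B, hB⟩ := hb.esize_le
  obtain ⟨G, hG⟩ := hg.esize_le
  have key : ∀ c (l' : List α) b M, (∀ a ∈ l', esize (g (c, a)) ≤ M) →
      esize (l'.foldl (f c) b) ≤ esize b + l'.length * M := by
    intro c l'
    induction l' with
    | nil => intro b M _; simp
    | cons a l' ih =>
      intro b M hM
      have h1 := ih (f c b a) M fun x hx => hM x (by simp [hx])
      have h2 := h c b a
      have h3 := hM a (by simp)
      simp only [List.foldl_cons, List.length_cons, add_mul, one_mul]
      omega
  refine foldl_of_bound hf hl hb (R := B + S * G.comp (.X + S + 1)) fun c l₁ l₂ hc => ?_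
  refine (key c l₁ (b c) (G.eval (esize c + S.eval (esize c) + 1)) fun a ha => ?_).trans ?_
  · refine (hG _).trans (eval_mono _ ?_)
    have h1 : esize a ≤ esize (l c) := esize_le_of_mem (by rw [hc]; simp [ha])
    have h2 := hS c
    rw [esize_pair]
    omega
  · simp only [Polynomial.eval_add, Polynomial.eval_mul, Polynomial.eval_comp, Polynomial.eval_X,
      Polynomial.eval_one]
    have h1 : l₁.length ≤ S.eval (esize c) :=
      le_trans (by rw [hc]; simp) ((length_le_esize (l c)).trans (hS c))
    gcongr
    exact hB c

@[fun_prop]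
theorem reverse {l : γ → List α} (hl : PolyTime l) : PolyTime fun c => (l c).reverse := by
  have := foldl (f := fun (_ : γ) (b : List α) a => a :: b) (b := fun _ => [])
    (g := fun x : γ × α => [x.2]) (by fun_prop) hl (by fun_prop) (by fun_prop)
    (fun c b a => by simp; omega)
  simpa using this

@[fun_prop]
theorem append {l l' : γ → List α} (hl : PolyTime l) (hl' : PolyTime l') :
    PolyTime fun c => l c ++ l' c := by
  have := foldl (f := fun (_ : γ) (b : List α) a => a :: b) (l := fun c => (l c).reverse)
    (b := l') (g := fun x : γ × α => [x.2]) (by fun_prop) (by fun_prop) hl' (by fun_prop)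
    (fun c b a => by simp; omega)
  simpa using this

@[fun_prop]
theorem flatMap {f : γ → α → List β} {l : γ → List α} (hf : PolyTime fun x : γ × α => f x.1 x.2)
    (hl : PolyTime l) : PolyTime fun c => (l c).flatMap fun a => f c a := by
  have := foldl (f := fun (c : γ) (b : List β) a => b ++ f c a) (b := fun _ => []) (l := l)
    (g := fun x : γ × α => f x.1 x.2) (by fun_prop) hl (by fun_prop) (by fun_prop)
    (fun c b a => by have := esize_append b (f c a); dsimp only; omega)
  convert this using 2 with c
  have key : ∀ (l : List α) (b : List β),
      l.foldl (fun b a => b ++ f c a) b = b ++ l.flatMap fun a => f c a := by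
    intro l
    induction l with
    | nil => simp
    | cons a l ih => intro b; simp [ih]
  simp [key]

@[fun_prop]
theorem map {f : γ → α → β} {l : γ → List α} (hf : PolyTime fun x : γ × α => f x.1 x.2)
    (hl : PolyTime l) : PolyTime fun c => (l c).map fun a => f c a := by
  have : PolyTime fun c => (l c).flatMap fun a => [f c a] := by fun_prop
  convert this using 2 with c
  induction l c with
  | nil => rfl
  | cons a l ih => simp [ih]

@[fun_prop]
theorem filter {p : γ → α → Bool} {l : γ → List α} (hp : PolyTime fun x : γ × α => p x.1 x.2)
    (hl : PolyTime l) : PolyTime fun c => (l c).filter fun a => p c a := by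
  have : PolyTime fun c => (l c).flatMap fun a => bif p c a then [a] else [] := by fun_prop
  convert this using 2 with c
  induction l c with
  | nil => simp
  | cons a l ih => cases h : p c a <;> simp [h, ih]

@[fun_prop]
theorem any {p : γ → α → Bool} {l : γ → List α} (hp : PolyTime fun x : γ × α => p x.1 x.2)
    (hl : PolyTime l) : PolyTime fun c => (l c).any fun a => p c a := by
  have : PolyTime fun c => !((l c).filter fun a => p c a).isEmpty := by fun_prop
  convert this using 2 with c
  induction l c with
  | nil => simp
  | cons a l ih => cases h : p c a <;> simp [h, ih]

@[fun_prop]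
theorem all {p : γ → α → Bool} {l : γ → List α} (hp : PolyTime fun x : γ × α => p x.1 x.2)
    (hl : PolyTime l) : PolyTime fun c => (l c).all fun a => p c a := by
  have : PolyTime fun c => !(l c).any fun a => !p c a := by fun_prop
  convert this using 2 with c
  induction l c with
  | nil => simp
  | cons a l ih => cases h : p c a <;> simp [h, ih]

@[fun_prop]
theorem length {l : γ → List α} (hl : PolyTime l) : PolyTime fun c => (l c).length := by
  have := foldl (f := fun (_ : γ) (b : ℕ) (_ : α) => b + 1) (b := fun _ => 0)
    (g := fun x : γ × α => (2 : ℕ)) (by fun_prop) hl (by fun_prop) (by fun_prop)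
    (fun c b a => by simp; omega)
  convert this using 2 with c
  have key : ∀ (l : List α) (b : ℕ), l.foldl (fun b _ => b + 1) b = b + l.length := by
    intro l
    induction l with
    | nil => simp
    | cons a l ih => intro b; simp [ih]; omega
  simp [key]

theorem replicate_nil {f : γ → ℕ} (hf : PolyTime f) :
    PolyTime fun c => List.replicate (f c) Data.nil := by
  have : PolyTime fun n => List.replicate n Data.nil := by
    unfold PolyTime
    convert PolyTimeComputable.refl (inp := fun n : ℕ => enc n) using 2 with n
    induction n with
    | zero => rfl
    | succ n ih =>
      change Data.node _ _ = Data.node _ _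
      congr 1
  exact this.comp hf

theorem foldl_replicate {α β : Type} (f : β → β) (n : ℕ) (a : α) (b : β) :
    (List.replicate n a).foldl (fun b _ => f b) b = f^[n] b := by
  induction n generalizing b with
  | zero => rfl
  | succ n ih => simp [List.replicate_succ, ih]

/-- Iterations are computed in polynomial time if every step adds at most the size of something that
is computable from the context alone. -/
theorem iterate {f : γ → β → β} {n : γ → ℕ} {b : γ → β} {g : γ → δ}
    (hf : PolyTime fun x : γ × β => f x.1 x.2) (hn : PolyTime n) (hb : PolyTime b)
    (hg : PolyTime g) (h : ∀ c b, esize (f c b) ≤ esize b + esize (g c)) :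
    PolyTime fun c => (f c)^[n c] (b c) := by
  have := foldl (f := fun c b (_ : Data) => f c b) (l := fun c => List.replicate (n c) Data.nil)
    (g := fun x : γ × Data => g x.1) (by fun_prop) (replicate_nil hn) hb (by fun_prop)
    (fun c b _ => h c b)
  simpa only [foldl_replicate] using this

@[fun_prop]
theorem add {f g : γ → ℕ} (hf : PolyTime f) (hg : PolyTime g) : PolyTime fun c => f c + g c := by
  have := iterate (f := fun (_ : γ) (b : ℕ) => b + 1) (g := fun _ => (2 : ℕ)) (by fun_prop) hg hf
    (by fun_prop) (fun c b => by simp; omega)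
  convert this using 2 with c
  induction g c with
  | zero => rfl
  | succ n ih => rw [Function.iterate_succ_apply', ← ih]; rfl

@[fun_prop]
theorem sub {f g : γ → ℕ} (hf : PolyTime f) (hg : PolyTime g) : PolyTime fun c => f c - g c := by
  have := iterate (f := fun (_ : γ) (b : ℕ) => b - 1) (g := fun _ => (2 : ℕ)) (by fun_prop) hg hf
    (by fun_prop) (fun c b => by simp; omega)
  convert this using 2 with c
  induction g c with
  | zero => rfl
  | succ n ih => rw [Function.iterate_succ_apply', ← ih]; rfl

@[fun_prop]
theorem mul {f g : γ → ℕ} (hf : PolyTime f) (hg : PolyTime g) : PolyTime fun c => f c * g c := by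
  have := iterate (f := fun (c : γ) (b : ℕ) => b + f c) (g := f) (b := fun _ => 0) (by fun_prop) hg
    (by fun_prop) hf (fun c b => by simp; omega)
  convert this using 2 with c
  induction g c with
  | zero => rfl
  | succ n ih => rw [Function.iterate_succ_apply', ← ih]; rfl

@[fun_prop]
theorem pow {f : γ → ℕ} (hf : PolyTime f) (d : ℕ) : PolyTime fun c => f c ^ d := by
  induction d with
  | zero => simpa using const 1
  | succ d ih => simpa only [pow_succ] using ih.mul hf

@[fun_prop]
theorem decide_le {f g : γ → ℕ} (hf : PolyTime f) (hg : PolyTime g) :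
    PolyTime fun c => decide (f c ≤ g c) := by
  have : PolyTime fun c => (List.replicate (f c - g c) Data.nil).isEmpty :=
    (replicate_nil (hf.sub hg)).isEmpty
  convert this using 2 with c
  rw [Bool.eq_iff_iff]
  simp [Nat.sub_eq_zero_iff_le]

@[fun_prop]
theorem beq {f g : γ → ℕ} (hf : PolyTime f) (hg : PolyTime g) : PolyTime fun c => f c == g c := by
  have : PolyTime fun c => decide (f c ≤ g c) && decide (g c ≤ f c) := by fun_prop
  convert this using 2 with c
  rw [Bool.eq_iff_iff]
  simp only [beq_iff_eq, Bool.and_eq_true, decide_eq_true_eq]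
  exact le_antisymm_iff

@[fun_prop]
theorem contains {l : γ → List ℕ} {f : γ → ℕ} (hl : PolyTime l) (hf : PolyTime f) :
    PolyTime fun c => (l c).contains (f c) := by
  have : PolyTime fun c => (l c).any fun a => f c == a := by fun_prop
  convert this using 2 with c
  exact List.contains_eq_any_beq

@[fun_prop]
theorem drop {f : γ → ℕ} {l : γ → List α} (hf : PolyTime f) (hl : PolyTime l) :
    PolyTime fun c => (l c).drop (f c) := by
  have := iterate (f := fun (_ : γ) (b : List α) => b.tail) (g := fun _ => (2 : ℕ)) (by fun_prop) hf
    hl (by fun_prop) (fun c b => by have := esize_le_of_sublist b.tail_sublist; omega)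
  convert this using 2 with c
  induction f c with
  | zero => rfl
  | succ n ih => rw [Function.iterate_succ_apply', ← ih]; simp

/-- Access to a list, where the default value has to be the element that is coded by `nil`. -/
theorem getD {f : γ → ℕ} {l : γ → List α} (hf : PolyTime f) (hl : PolyTime l) {d : α}
    (hd : enc d = .nil) : PolyTime fun c => (l c).getD (f c) d := by
  convert (drop hf hl).headD hd using 2 with c
  simp [List.headD_eq_head?_getD]

@[fun_prop]
theorem getD_zero {f : γ → ℕ} {l : γ → List ℕ} (hf : PolyTime f) (hl : PolyTime l) :
    PolyTime fun c => (l c).getD (f c) 0 := getD hf hl rfl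

@[fun_prop]
theorem getD_false {f : γ → ℕ} {l : γ → List Bool} (hf : PolyTime f) (hl : PolyTime l) :
    PolyTime fun c => (l c).getD (f c) false := getD hf hl rfl

@[fun_prop]
theorem getD_nil {f : γ → ℕ} {l : γ → List (List α)} (hf : PolyTime f) (hl : PolyTime l) :
    PolyTime fun c => (l c).getD (f c) [] := getD hf hl rfl

@[fun_prop]
theorem headD_zero {l : γ → List ℕ} (hl : PolyTime l) :
    PolyTime fun c => (l c).headD 0 := headD hl rfl

@[fun_prop]
theorem take_one {l : γ → List α} (hl : PolyTime l) : PolyTime fun c => (l c).take 1 := by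
  have := foldl (f := fun (_ : γ) (b : List α) a => bif b.isEmpty then [a] else b)
    (b := fun _ => []) (g := fun x : γ × α => [x.2]) (by fun_prop) hl (by fun_prop) (by fun_prop)
    (fun c b a => by cases b <;> simp)
  convert this using 2 with c
  have key : ∀ (l : List α) (a : α),
      l.foldl (fun (b : List α) a => bif b.isEmpty then [a] else b) [a] = [a] := by
    intro l
    induction l with
    | nil => simp
    | cons a l ih => intro b; simpa using ih b
  cases l c with
  | nil => rfl
  | cons a l => simp [key]

theorem esize_range_le (n : ℕ) : esize (List.range n) ≤ n * (2 * n + 2) + 1 := by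
  induction n with
  | zero => simp
  | succ n ih =>
    have := esize_append (List.range n) [n]
    rw [List.range_succ]
    simp only [esize_cons, esize_nil, esize_nat] at this
    nlinarith

@[fun_prop]
theorem range {f : γ → ℕ} (hf : PolyTime f) : PolyTime fun c => List.range (f c) := by
  have key : ∀ n, (List.replicate n Data.nil).foldl (fun (b : List ℕ) _ => b ++ [b.length]) [] =
      List.range n := by
    intro n
    induction n with
    | zero => rfl
    | succ n ih => rw [List.replicate_succ', List.foldl_concat, ih]; simp [List.range_succ]
  obtain ⟨F, hF⟩ := hf.esize_le
  have := foldl_of_bound (f := fun (_ : γ) (b : List ℕ) (_ : Data) => b ++ [b.length])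
    (l := fun c => List.replicate (f c) Data.nil) (b := fun _ => []) (by fun_prop)
    (replicate_nil hf) (by fun_prop) (R := F * (2 * F + 2) + 1) (fun c l₁ l₂ h => by
      have h1 := List.eq_replicate_of_mem (l := l₁) (a := Data.nil) fun b hb =>
        List.eq_of_mem_replicate (h ▸ List.mem_append_left _ hb)
      have h2 : l₁.length ≤ f c := by
        have := congrArg List.length h
        simp at this
        omega
      have h3 : f c ≤ F.eval (esize c) := by
        have := hF c
        rw [esize_nat] at this
        omega
      rw [h1, key]
      refine (esize_range_le _).trans ?_
      simp only [Polynomial.eval_mul, Polynomial.eval_add, Polynomial.eval_one,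
        Polynomial.eval_ofNat]
      have := h2.trans h3
      gcongr)
  simpa only [key] using this

end PolyTime

/-! ### The kernelization algorithm on adjacency matrices -/

/-- Adjacency, read off a Boolean matrix that is given as the list of its rows. -/
def adj (M : List (List Bool)) (u v : ℕ) : Bool := (M.getD u []).getD v false

/-- Membership of `v` in the closed neighbourhood of `u`. -/
def near (M : List (List Bool)) (u v : ℕ) : Bool := (u == v) || adj M u v

/-- `z` lies in the closed neighbourhood of the set `X`. -/
def dominates (M : List (List Bool)) (X : List ℕ) (z : ℕ) : Bool := X.any fun x => near M x z

/-- The vertices of the graph with adjacency matrix `M`. -/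
def verts (M : List (List Bool)) : List ℕ := List.range M.length

/-- Connectedness of the subgraph induced by `X`: breadth-first search from the first element of `X`
reaches everything within `X.length` rounds. -/
def connected (M : List (List Bool)) (X : List ℕ) : Bool :=
  !X.isEmpty && X.all fun x =>
    ((fun R => X.filter fun y => dominates M R y)^[X.length] (X.take 1)).contains x

/-- Starting with the set `W`, pass at most `i` times to the part of `W` in the closed neighbourhood
of a further vertex outside `A` that covers at least the fraction `1 / r` of `W`. -/
def concentrate (M : List (List Bool)) (r : ℕ) : ℕ → List ℕ → List ℕ → List ℕ
  | 0, _, W => W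
  | i + 1, A, W =>
    let c := (verts M).filter fun v =>
      !A.contains v && decide (W.length ≤ r * (W.filter fun w => near M v w).length)
    bif c.isEmpty then W
    else concentrate M r i (c.headD 0 :: A) (W.filter fun w => near M (c.headD 0) w)

/-- Add a vertex to the core, and, if it gets too large, delete one that is dominated by every small
set which dominates the others. -/
def coreStep (M : List (List Bool)) (d r B : ℕ) (Z : List ℕ) (v : ℕ) : List ℕ :=
  bif decide ((v :: Z).length ≤ B) then v :: Z
  else (v :: Z).filter fun x => !(x == (concentrate M r d [] (v :: Z)).headD 0)

/-- The domination core: a set of at most `B` vertices such that every small set which dominates it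
dominates the whole graph. -/
def core (M : List (List Bool)) (d r B : ℕ) : List ℕ :=
  (verts M).foldl (fun Z v => coreStep M d r B Z v) []

/-- All lists of `j` vertices. -/
def tuples (M : List (List Bool)) : ℕ → List (List ℕ)
  | 0 => [[]]
  | j + 1 => (verts M).flatMap fun v => (tuples M j).map fun X => v :: X

/-- `X` and `Y` dominate the same vertices of `Z`. -/
def sameTrace (M : List (List Bool)) (Z X Y : List ℕ) : Bool :=
  Z.all fun z => dominates M X z == dominates M Y z

/-- One element of `L` for every set of vertices of `Z` that is dominated by an element of `L`. -/
def representatives (M : List (List Bool)) (Z : List ℕ) (L : List (List ℕ)) : List (List ℕ) :=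
  L.foldl (fun acc X => bif acc.any (fun Y => sameTrace M Z X Y) then acc else X :: acc) []

/-- For every positive length up to `j`, representatives of the connected lists of vertices of that
length. -/
def pieces (M : List (List Bool)) (Z : List ℕ) : ℕ → List (List ℕ)
  | 0 => []
  | j + 1 =>
    representatives M Z ((tuples M (j + 1)).filter fun X => connected M X) ++ pieces M Z j

/-- The at most two inner vertices of a walk of length at most three from `x` to `y`, if there is such
a walk; a shorter walk is padded by repeating vertices. -/
def link (M : List (List Bool)) (x y : ℕ) : List ℕ :=
  (((verts M).flatMap fun a => bif near M x a then
      ((verts M).filter fun b => near M a b && near M b y).map fun b => [a, b]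
    else []).take 1).flatMap fun l => l

/-- The links between all pairs of elements of `U`. -/
def links (M : List (List Bool)) (U : List ℕ) : List ℕ :=
  U.flatMap fun x => U.flatMap fun y => link M x y

/-- The core and the representatives of connected pieces, before links are added.  The core is made for
dominating sets of less than `2 * k + 1` vertices, since a solution of at most `k` vertices is replaced
by pieces which have at most `2 * k` vertices together. -/
def seed (d s : ℕ) (M : List (List Bool)) (k : ℕ) : List ℕ :=
  core M d (2 * k + 1) (2 * d * (2 * k + 1) ^ d) ++
    (pieces M (core M d (2 * k + 1) (2 * d * (2 * k + 1) ^ d)) (2 * s)).flatMap fun X => X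

/-- The seed with its links, as an increasing list. -/
def linkedSeed (d s : ℕ) (M : List (List Bool)) (k : ℕ) : List ℕ :=
  (verts M).filter fun v => (seed d s M k ++ links M (seed d s M k)).contains v

/-- A single vertex, which dominates the graph if there is such a vertex. -/
def fallback (M : List (List Bool)) : List ℕ :=
  (((verts M).filter fun v => (verts M).all fun w => near M v w) ++ verts M).take 1

/-- The vertices of the kernel.  The size bound leaves room for only one vertex if `k ≤ 1`; and if the
linked seed is not connected, then there is no connected dominating set of at most `k` vertices, and
any connected graph serves as a kernel. -/
def kernelVerts (d s : ℕ) (M : List (List Bool)) (k : ℕ) : List ℕ :=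
  bif decide (2 ≤ k) && connected M (linkedSeed d s M k) then linkedSeed d s M k else fallback M

/-- The adjacency matrix of an induced subgraph. -/
def submatrix (M : List (List Bool)) (U : List ℕ) : List (List Bool) :=
  U.map fun u => U.map fun v => adj M u v

/-- The vertices of the kernel that are selected by a list of bits. -/
def selected (U : List ℕ) (bits : List Bool) : List ℕ :=
  ((List.range U.length).filter fun i => bits.getD i false).map fun i => U.getD i 0

/-- A set of vertices as a list of bits: `S` if this is a connected dominating set, and the set of all
vertices otherwise. -/
def solutionBits (M : List (List Bool)) (S : List ℕ) : List Bool :=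
  bif connected M S && (verts M).all fun v => dominates M S v then
    (verts M).map fun v => S.contains v
  else (verts M).map fun _ => true

namespace PolyTime

variable {γ : Type} [Enc γ]

@[fun_prop]
theorem beq_bool {f g : γ → Bool} (hf : PolyTime f) (hg : PolyTime g) :
    PolyTime fun c => f c == g c := by
  have : PolyTime fun c => (f c && g c) || (!(f c) && !(g c)) := by fun_prop
  convert this using 2 with c
  cases f c <;> cases g c <;> rfl

variable {M : γ → List (List Bool)} {u v : γ → ℕ} {X Y Z U : γ → List ℕ}

@[fun_prop]
theorem adj (hM : PolyTime M) (hu : PolyTime u) (hv : PolyTime v) :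
    PolyTime fun c => adj (M c) (u c) (v c) := by
  unfold LossyKernel.adj; fun_prop

@[fun_prop]
theorem near (hM : PolyTime M) (hu : PolyTime u) (hv : PolyTime v) :
    PolyTime fun c => near (M c) (u c) (v c) := by
  unfold LossyKernel.near; fun_prop

@[fun_prop]
theorem dominates (hM : PolyTime M) (hX : PolyTime X) (hv : PolyTime v) :
    PolyTime fun c => dominates (M c) (X c) (v c) := by
  unfold LossyKernel.dominates; fun_prop

@[fun_prop]
theorem verts (hM : PolyTime M) : PolyTime fun c => verts (M c) := by
  unfold LossyKernel.verts; fun_prop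

@[fun_prop]
theorem connected (hM : PolyTime M) (hX : PolyTime X) :
    PolyTime fun c => connected (M c) (X c) := by
  unfold LossyKernel.connected
  have : PolyTime fun c => (fun R => (X c).filter fun y => LossyKernel.dominates (M c) R y)^[
      (X c).length] ((X c).take 1) :=
    iterate (f := fun c R => (X c).filter fun y => LossyKernel.dominates (M c) R y) (g := X)
      (by fun_prop) (by fun_prop) (by fun_prop) hX fun c R =>
        (esize_le_of_sublist List.filter_sublist).trans (Nat.le_add_left _ _)
  exact and (by fun_prop) (all (contains (this.comp fst) snd) hX)

@[fun_prop]
theorem concentrate (hM : PolyTime M) (hu : PolyTime u) (i : ℕ) (hX : PolyTime X)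
    (hY : PolyTime Y) : PolyTime fun c => concentrate (M c) (u c) i (X c) (Y c) := by
  induction i generalizing X Y with
  | zero => exact hY
  | succ i ih =>
    unfold LossyKernel.concentrate
    exact cond (by fun_prop) hY (ih (by fun_prop) (by fun_prop))

@[fun_prop]
theorem coreStep (hM : PolyTime M) (d : ℕ) {r B : γ → ℕ} (hr : PolyTime r) (hB : PolyTime B)
    (hZ : PolyTime Z) (hv : PolyTime v) :
    PolyTime fun c => coreStep (M c) d (r c) (B c) (Z c) (v c) := by
  unfold LossyKernel.coreStep; fun_prop

@[fun_prop]
theorem core (hM : PolyTime M) (d : ℕ) {r B : γ → ℕ} (hr : PolyTime r) (hB : PolyTime B) :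
    PolyTime fun c => core (M c) d (r c) (B c) := by
  unfold LossyKernel.core
  refine foldl (f := fun c Z v => LossyKernel.coreStep (M c) d (r c) (B c) Z v)
    (g := fun x : γ × ℕ => [x.2]) (by fun_prop) (by fun_prop) (by fun_prop) (by fun_prop) ?_
  intro c Z v
  have h : esize (LossyKernel.coreStep (M c) d (r c) (B c) Z v) ≤ esize (v :: Z) := by
    unfold LossyKernel.coreStep
    rw [Bool.cond_eq_ite]
    split_ifs
    · rfl
    · exact esize_le_of_sublist List.filter_sublist
  simp at h ⊢
  omega

@[fun_prop]
theorem tuples (hM : PolyTime M) (j : ℕ) : PolyTime fun c => tuples (M c) j := by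
  induction j with
  | zero => exact const [[]]
  | succ j ih =>
    unfold LossyKernel.tuples
    exact flatMap (map (f := fun x : γ × ℕ => fun X => x.2 :: X) (by fun_prop) (ih.comp fst))
      (by fun_prop)

@[fun_prop]
theorem sameTrace (hM : PolyTime M) (hZ : PolyTime Z) (hX : PolyTime X) (hY : PolyTime Y) :
    PolyTime fun c => sameTrace (M c) (Z c) (X c) (Y c) := by
  unfold LossyKernel.sameTrace; fun_prop

@[fun_prop]
theorem representatives (hM : PolyTime M) (hZ : PolyTime Z) {L : γ → List (List ℕ)}
    (hL : PolyTime L) : PolyTime fun c => representatives (M c) (Z c) (L c) := by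
  unfold LossyKernel.representatives
  refine foldl (f := fun c acc X =>
      bif acc.any (fun Y => LossyKernel.sameTrace (M c) (Z c) X Y) then acc else X :: acc)
    (b := fun _ => []) (g := fun x : γ × List ℕ => [x.2]) (by fun_prop) hL (by fun_prop) (by fun_prop) ?_
  intro c acc X
  dsimp only
  rw [Bool.cond_eq_ite]
  split_ifs <;> simp
  omega

@[fun_prop]
theorem pieces (hM : PolyTime M) (hZ : PolyTime Z) (j : ℕ) :
    PolyTime fun c => pieces (M c) (Z c) j := by
  induction j with
  | zero => exact const []
  | succ j ih => unfold LossyKernel.pieces; fun_prop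

@[fun_prop]
theorem link (hM : PolyTime M) (hu : PolyTime u) (hv : PolyTime v) :
    PolyTime fun c => link (M c) (u c) (v c) := by
  unfold LossyKernel.link; fun_prop

@[fun_prop]
theorem links (hM : PolyTime M) (hU : PolyTime U) : PolyTime fun c => links (M c) (U c) := by
  unfold LossyKernel.links; fun_prop

@[fun_prop]
theorem seed (d s : ℕ) (hM : PolyTime M) {k : γ → ℕ} (hk : PolyTime k) :
    PolyTime fun c => seed d s (M c) (k c) := by
  unfold LossyKernel.seed; fun_prop

@[fun_prop]
theorem linkedSeed (d s : ℕ) (hM : PolyTime M) {k : γ → ℕ} (hk : PolyTime k) :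
    PolyTime fun c => linkedSeed d s (M c) (k c) := by
  unfold LossyKernel.linkedSeed; fun_prop

@[fun_prop]
theorem fallback (hM : PolyTime M) : PolyTime fun c => fallback (M c) := by
  unfold LossyKernel.fallback; fun_prop

@[fun_prop]
theorem kernelVerts (d s : ℕ) (hM : PolyTime M) {k : γ → ℕ} (hk : PolyTime k) :
    PolyTime fun c => kernelVerts d s (M c) (k c) := by
  unfold LossyKernel.kernelVerts; fun_prop

@[fun_prop]
theorem submatrix (hM : PolyTime M) (hU : PolyTime U) :
    PolyTime fun c => submatrix (M c) (U c) := by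
  unfold LossyKernel.submatrix; fun_prop

@[fun_prop]
theorem selected (hU : PolyTime U) {b : γ → List Bool} (hb : PolyTime b) :
    PolyTime fun c => selected (U c) (b c) := by
  unfold LossyKernel.selected; fun_prop

@[fun_prop]
theorem solutionBits (hM : PolyTime M) (hU : PolyTime U) :
    PolyTime fun c => solutionBits (M c) (U c) := by
  unfold LossyKernel.solutionBits; fun_prop

end PolyTime

/-- The reduction algorithm works in polynomial time. -/
theorem polyTime_reduce (d s : ℕ) :
    PolyTime fun x : List (List Bool) × ℕ => (submatrix x.1 (kernelVerts d s x.1 x.2), x.2) := by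
  fun_prop

/-- The solution lifting algorithm works in polynomial time. -/
theorem polyTime_lift (d s : ℕ) :
    PolyTime fun x : (List (List Bool) × ℕ) × (List (List Bool) × ℕ) × List Bool =>
      solutionBits x.1.1 (selected (kernelVerts d s x.1.1 x.1.2) x.2.2) := by
  fun_prop

/-! ### Connected and dominating sets of vertices -/

section Graph

variable {V : Type} {G : SimpleGraph V}

/-- `v` lies in the closed neighbourhood of `u`. -/
def Near (G : SimpleGraph V) (u v : V) : Prop := u = v ∨ G.Adj u v

/-- Every element of `Y` lies in the closed neighbourhood of the set `X`. -/
def Dominates (G : SimpleGraph V) (X Y : Finset V) : Prop := ∀ y ∈ Y, ∃ x ∈ X, Near G x y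

/-- The subgraph induced by `S` is connected, in particular nonempty. -/
def Conn (G : SimpleGraph V) (S : Finset V) : Prop := (G.induce (S : Set V)).Connected

theorem Near.symm {u v : V} (h : Near G u v) : Near G v u :=
  h.imp Eq.symm SimpleGraph.Adj.symm

theorem Near.refl (u : V) : Near G u u := .inl rfl

/-- A nonempty set is connected if and only if it has an edge across every cut. -/
theorem conn_iff_cut {S : Finset V} : Conn G S ↔ S.Nonempty ∧
    ∀ A : Set V, (∃ a ∈ S, a ∈ A) → (∃ b ∈ S, b ∉ A) →
      ∃ a ∈ S, ∃ b ∈ S, a ∈ A ∧ b ∉ A ∧ G.Adj a b := by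
  constructor
  · intro h
    refine ⟨?_, ?_⟩
    · obtain ⟨v⟩ := h.nonempty
      exact ⟨v.1, v.2⟩
    · rintro A ⟨a, haS, ha⟩ ⟨b, hbS, hb⟩
      obtain ⟨p⟩ := h.preconnected ⟨a, haS⟩ ⟨b, hbS⟩
      obtain ⟨e, -, h1, h2⟩ := p.exists_boundary_dart (Subtype.val ⁻¹' A) ha hb
      exact ⟨_, e.fst.2, _, e.snd.2, h1, h2, e.adj⟩
  · rintro ⟨⟨v, hv⟩, h⟩
    refine (SimpleGraph.connected_iff_exists_forall_reachable _).2 ⟨⟨v, hv⟩, ?_⟩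
    rintro ⟨w, hw⟩
    by_contra hvw
    obtain ⟨a, ha, b, hb, ⟨_, ha'⟩, hb', hab⟩ :=
      h {x | ∃ hx : x ∈ S, (G.induce (S : Set V)).Reachable ⟨v, hv⟩ ⟨x, hx⟩} ⟨v, hv, hv, .rfl⟩
        ⟨w, hw, fun ⟨_, h⟩ => hvw h⟩
    have : (G.induce (S : Set V)).Adj ⟨a, ha⟩ ⟨b, hb⟩ := hab
    exact hb' ⟨hb, ha'.trans this.reachable⟩

theorem Conn.nonempty {S : Finset V} (h : Conn G S) : S.Nonempty := (conn_iff_cut.1 h).1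

theorem Conn.cut {S : Finset V} (h : Conn G S) (A : Set V) {a b : V} (ha : a ∈ S) (haA : a ∈ A)
    (hb : b ∈ S) (hbA : b ∉ A) : ∃ a ∈ S, ∃ b ∈ S, a ∈ A ∧ b ∉ A ∧ G.Adj a b :=
  (conn_iff_cut.1 h).2 A ⟨a, ha, haA⟩ ⟨b, hb, hbA⟩

theorem conn_singleton (v : V) : Conn G {v} := by
  refine conn_iff_cut.2 ⟨⟨v, by simp⟩, ?_⟩
  rintro A ⟨a, ha, ha'⟩ ⟨b, hb, hb'⟩
  simp only [Finset.mem_singleton] at ha hb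
  exact absurd (by rwa [hb, ← ha]) hb'

/-- If `U₀` dominates a connected graph, then `U₀` together with a walk of length at most three
between any two of its elements that have such a walk is connected. -/
theorem conn_of_links {W U₀ U : Finset V} (hW : Conn G W) (hdom : Dominates G U₀ W) (hU₀ : U₀ ⊆ U)
    (hUW : U ⊆ W) (hnear : Dominates G U₀ U)
    (hlink : ∀ x ∈ U₀, ∀ y ∈ U₀, (∃ a ∈ W, ∃ b ∈ W, Near G x a ∧ Near G a b ∧ Near G b y) →
      ∃ a ∈ U, ∃ b ∈ U, Near G x a ∧ Near G a b ∧ Near G b y) : Conn G U := by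
  obtain ⟨w, hw⟩ := hW.nonempty
  obtain ⟨x, hx, -⟩ := hdom w hw
  refine conn_iff_cut.2 ⟨⟨x, hU₀ hx⟩, ?_⟩
  rintro A ⟨p, hp, hpA⟩ ⟨q, hq, hqA⟩
  by_contra hno
  push Not at hno
  have hstep : ∀ u ∈ U, ∀ v ∈ U, Near G u v → (u ∈ A ↔ v ∈ A) := by
    rintro u hu v hv (rfl | huv)
    · rfl
    · constructor
      · exact fun h => by_contra fun h' => hno u hu v hv h h' huv
      · exact fun h => by_contra fun h' => hno v hv u hu h h' huv.symm
  obtain ⟨x, hx, hxp⟩ := hnear p hp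
  obtain ⟨y, hy, hyq⟩ := hnear q hq
  have hxA := (hstep x (hU₀ hx) p hp hxp).2 hpA
  have hyA := mt (hstep y (hU₀ hy) q hq hyq).1 hqA
  have hno' : ∀ x ∈ U₀, ∀ y ∈ U₀, x ∈ A → y ∉ A →
      ¬∃ a ∈ W, ∃ b ∈ W, Near G x a ∧ Near G a b ∧ Near G b y := by
    intro x hx y hy hxA hyA h
    obtain ⟨a, ha, b, hb, h1, h2, h3⟩ := hlink x hx y hy h
    exact hyA ((hstep b hb y (hU₀ hy) h3).1 ((hstep a ha b hb h2).1
      ((hstep x (hU₀ hx) a ha h1).1 hxA)))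
  obtain ⟨a, ha, b, hb, ⟨x', hx', hx'A, hn⟩, hbA, hab⟩ :=
    hW.cut {u | ∃ x ∈ U₀, x ∈ A ∧ Near G x u} (hUW (hU₀ hx)) ⟨x, hx, hxA, .refl x⟩
      (hUW (hU₀ hy)) (by
        rintro ⟨x', hx', hx'A, hn⟩
        exact hno' x' hx' y hy hx'A hyA
          ⟨y, hUW (hU₀ hy), y, hUW (hU₀ hy), hn, .refl y, .refl y⟩)
  obtain ⟨y', hy', hn'⟩ := hdom b hb
  by_cases hy'A : y' ∈ A
  · exact hbA ⟨y', hy', hy'A, hn'⟩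
  · exact hno' x' hx' y' hy' hx'A hy'A ⟨a, ha, b, hb, hn, .inr hab, hn'.symm⟩

variable [DecidableEq V]

theorem Conn.union {S T : Finset V} (hS : Conn G S) (hT : Conn G T) {v w : V} (hv : v ∈ S)
    (hw : w ∈ T) (h : Near G v w) : Conn G (S ∪ T) := by
  unfold Conn
  rw [Finset.coe_union]
  rcases h with rfl | h
  · exact SimpleGraph.induce_union_connected hS.preconnected hT.preconnected ⟨v, hv, hw⟩
  · exact SimpleGraph.connected_induce_union hS.preconnected hT.preconnected hv hw h

theorem Conn.insert_of_near {S : Finset V} (hS : Conn G S) {v w : V} (hv : v ∈ S) (h : Near G v w) :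
    Conn G (insert w S) := by
  rw [Finset.insert_eq, Finset.union_comm]
  exact hS.union (conn_singleton w) hv (by simp) h

/-- A connected set with a root `v` is a single vertex, or it is split by an edge at `v` into two
connected sets. -/
theorem Conn.exists_split {D : Finset V} (hD : Conn G D) {v : V} (hv : v ∈ D) (hcard : 2 ≤ D.card) :
    ∃ K L w, Conn G K ∧ Conn G L ∧ v ∈ L ∧ w ∈ K ∧ G.Adj v w ∧ Disjoint K L ∧ K ∪ L = D := by
  classical
  obtain ⟨x, hx, hxv⟩ := Finset.exists_mem_ne (s := D) (by omega) v
  -- `K` is a component of `D` without `v`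
  obtain ⟨K, hK, hmax⟩ := Finset.exists_max_image
    ((D.erase v).powerset.filter fun K => Conn G K) Finset.card
    ⟨{x}, by simp [hx, hxv, conn_singleton]⟩
  simp only [Finset.mem_filter, Finset.mem_powerset] at hK hmax
  obtain ⟨hKD, hKc⟩ := hK
  have hvK : v ∉ K := fun h => by simpa using hKD h
  have hKD' : K ⊆ D := hKD.trans (Finset.erase_subset _ _)
  have hfix : ∀ a ∈ K, ∀ b ∈ D, b ∉ K → G.Adj a b → b = v := by
    intro a ha b hb hbK hab
    by_contra hbv
    have := hmax (insert b K) ⟨?_, hKc.insert_of_near ha (.inr hab)⟩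
    · rw [Finset.card_insert_of_notMem hbK] at this
      omega
    · exact Finset.insert_subset (by simp [hb, hbv]) hKD
  obtain ⟨y, hy⟩ := hKc.nonempty
  obtain ⟨w, hwD, b, hbD, hwK, hbK, hwb⟩ := hD.cut K (hKD' hy) hy hv hvK
  obtain rfl := hfix w hwK b hbD hbK hwb
  refine ⟨K, D \ K, w, hKc, conn_iff_cut.2 ⟨⟨b, by simp [hv, hvK]⟩, ?_⟩, by simp [hv, hvK], hwK,
    hwb.symm, Finset.disjoint_sdiff, by simp [hKD']⟩
  have key : ∀ A : Set V, b ∉ A → (∃ a ∈ D \ K, a ∈ A) →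
      ∃ x ∈ D \ K, ∃ y ∈ D \ K, x ∈ A ∧ y ∉ A ∧ G.Adj x y := by
    rintro A hA ⟨a, haL, ha⟩
    rw [Finset.mem_sdiff] at haL
    obtain ⟨x, hx, y, hy, ⟨hxA, hxK⟩, hyA, hxy⟩ :=
      hD.cut {x | x ∈ A ∧ x ∉ K} haL.1 ⟨ha, haL.2⟩ hv fun h => hA h.1
    by_cases hyK : y ∈ K
    · exact absurd (hfix y hyK x hx hxK hxy.symm ▸ hxA) hA
    · exact ⟨x, by simp [hx, hxK], y, by simp [hy, hyK], hxA, fun h => hyA ⟨h, hyK⟩, hxy⟩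
  intro A h1 h2
  by_cases hbA : b ∈ A
  · obtain ⟨x, hx, y, hy, hxA, hyA, hxy⟩ := key Aᶜ (by simpa using hbA) h2
    exact ⟨y, hy, x, hx, by simpa using hyA, hxA, hxy.symm⟩
  · exact key A hbA h1

/-- A connected set with a root `v` is cut into connected pieces of size between `s + 1` and `2 * s`
and a rest of size at most `s` that contains the root; cutting off a piece duplicates one vertex. -/
theorem Conn.exists_rooted_pieces {s : ℕ} (hs : 1 ≤ s) (n : ℕ) {D : Finset V} (hn : D.card = n)
    (hD : Conn G D) {v : V} (hv : v ∈ D) :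
    ∃ (L : List (Finset V)) (R : Finset V), v ∈ R ∧ Conn G R ∧ R.card ≤ s ∧
      (∀ X ∈ L, Conn G X ∧ s + 1 ≤ X.card ∧ X.card ≤ 2 * s) ∧
      (∀ x, x ∈ D ↔ x ∈ R ∨ ∃ X ∈ L, x ∈ X) ∧
      (L.map Finset.card).sum + R.card = D.card + L.length := by
  induction n using Nat.strong_induction_on generalizing D v with
  | _ n ih =>
    rcases Nat.lt_or_ge D.card 2 with h1 | h2
    · have : D = {v} := by
        have := Finset.card_pos.2 ⟨v, hv⟩
        obtain ⟨u, rfl⟩ := Finset.card_eq_one.1 (by omega : D.card = 1)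
        simp at hv
        rw [hv]
      subst this
      exact ⟨[], {v}, by simp, conn_singleton v, by simpa using hs, by simp, by simp, by simp⟩
    · obtain ⟨K, T, w, hK, hT, hvT, hwK, hvw, hdisj, rfl⟩ := hD.exists_split hv h2
      have hcard := Finset.card_union_of_disjoint hdisj
      have hKpos := Finset.card_pos.2 ⟨w, hwK⟩
      have hTpos := Finset.card_pos.2 ⟨v, hvT⟩
      obtain ⟨L₁, R₁, hw₁, hR₁, hs₁, hL₁, hc₁, hsum₁⟩ := ih K.card (by omega) rfl hK hwK
      obtain ⟨L₂, R₂, hv₂, hR₂, hs₂, hL₂, hc₂, hsum₂⟩ := ih T.card (by omega) rfl hT hvT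
      have hR : Conn G (R₂ ∪ R₁) := hR₂.union hR₁ hv₂ hw₁ (.inr hvw)
      have hRdisj : Disjoint R₂ R₁ := by
        rw [Finset.disjoint_left]
        intro x h2 h1
        exact Finset.disjoint_left.1 hdisj ((hc₁ x).2 (.inl h1)) ((hc₂ x).2 (.inl h2))
      have hRcard := Finset.card_union_of_disjoint hRdisj
      have hL : ∀ X ∈ L₁ ++ L₂, Conn G X ∧ s + 1 ≤ X.card ∧ X.card ≤ 2 * s := by
        intro X hX
        rcases List.mem_append.1 hX with h | h
        exacts [hL₁ X h, hL₂ X h]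
      have hc : ∀ x, x ∈ K ∪ T ↔ x ∈ R₂ ∪ R₁ ∨ ∃ X ∈ L₁ ++ L₂, x ∈ X := by
        intro x
        simp only [Finset.mem_union, hc₁, hc₂, List.mem_append, or_and_right, exists_or]
        grind
      by_cases hle : (R₂ ∪ R₁).card ≤ s
      · refine ⟨L₁ ++ L₂, R₂ ∪ R₁, by simp [hv₂], hR, hle, hL, hc, ?_⟩
        simp only [List.map_append, List.sum_append, List.length_append]
        omega
      · refine ⟨(R₂ ∪ R₁) :: (L₁ ++ L₂), {v}, by simp, conn_singleton v, by simpa using hs, ?_, ?_,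
          ?_⟩
        · intro X hX
          rcases List.mem_cons.1 hX with rfl | h
          · exact ⟨hR, by omega, by omega⟩
          · exact hL X h
        · intro x
          rw [hc x]
          simp only [List.mem_cons, exists_eq_or_imp, Finset.mem_singleton]
          constructor
          · exact .inr
          · rintro (rfl | h)
            · simp [hv₂]
            · exact h
        · simp only [List.map_cons, List.map_append, List.sum_cons, List.sum_append,
            List.length_cons, List.length_append, Finset.card_singleton]
          omega

/-- A connected set is the union of connected pieces of size at most `2 * s`, where `m + 1` pieces
contain `m` vertices more, counted with multiplicity, than the set itself, and `m * s` is smaller than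
the size of the set. -/
theorem Conn.exists_pieces {s : ℕ} (hs : 1 ≤ s) {D : Finset V} (hD : Conn G D) :
    ∃ (L : List (Finset V)) (m : ℕ), L.length = m + 1 ∧
      (∀ X ∈ L, Conn G X ∧ X.card ≤ 2 * s) ∧ (∀ x, x ∈ D ↔ ∃ X ∈ L, x ∈ X) ∧
      (L.map Finset.card).sum = D.card + m ∧ m * s ≤ D.card := by
  obtain ⟨v, hv⟩ := hD.nonempty
  obtain ⟨L, R, hvR, hR, hRs, hL, hc, hsum⟩ := hD.exists_rooted_pieces hs _ rfl hv
  refine ⟨R :: L, L.length, rfl, ?_, ?_, ?_, ?_⟩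
  · intro X hX
    rcases List.mem_cons.1 hX with rfl | h
    · exact ⟨hR, by omega⟩
    · exact ⟨(hL X h).1, (hL X h).2.2⟩
  · intro x
    simp [hc x]
  · simp only [List.map_cons, List.sum_cons]
    omega
  · have h1 : (L.map Finset.card).length • (s + 1) ≤ (L.map Finset.card).sum := by
      refine List.card_nsmul_le_sum _ _ fun x hx => ?_
      obtain ⟨X, hX, rfl⟩ := List.mem_map.1 hx
      exact (hL X hX).2.1
    rw [List.length_map, smul_eq_mul, mul_add] at h1
    omega

/-- In a connected graph, connected sets whose union is dominating are joined to one connected set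
by adding at most two vertices for every set but the first. -/
theorem exists_conn_of_dominating {U : Finset V} (hU : Conn G U) (m : ℕ) (L : List (Finset V))
    (hm : L.length = m + 1) (hL : ∀ X ∈ L, Conn G X ∧ X ⊆ U)
    (hdom : ∀ u ∈ U, ∃ X ∈ L, ∃ x ∈ X, Near G x u) :
    ∃ S ⊆ U, Conn G S ∧ Dominates G S U ∧ S.card ≤ (L.map Finset.card).sum + 2 * m := by
  induction m generalizing L with
  | zero =>
    obtain ⟨Y, rfl⟩ := List.length_eq_one_iff.1 hm
    have := hL Y (by simp)
    exact ⟨Y, this.2, this.1, fun u hu => by simpa using hdom u hu, by simp⟩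
  | succ m ih =>
    obtain _ | ⟨Y, L⟩ := L
    · simp at hm
    have hLm : L.length = m + 1 := by simpa using hm
    obtain ⟨hY, hYU⟩ := hL Y (by simp)
    have hL' : ∀ X ∈ L, Conn G X ∧ X ⊆ U := fun X hX => hL X (by simp [hX])
    -- two vertices on a path of length at most three between `Y` and another set
    obtain ⟨Y', hY'L, a, b, ha, hb, ⟨y, hy, hya⟩, hab, y', hy', hyb⟩ :
        ∃ Y' ∈ L, ∃ a b, a ∈ U ∧ b ∈ U ∧ (∃ y ∈ Y, Near G y a) ∧ Near G a b ∧
          ∃ y' ∈ Y', Near G y' b := by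
      by_cases h : ∃ u ∈ U, (∃ y ∈ Y, Near G y u) ∧ ∃ X ∈ L, ∃ x ∈ X, Near G x u
      · obtain ⟨u, hu, h1, X, hX, h2⟩ := h
        exact ⟨X, hX, u, u, hu, hu, h1, .refl u, h2⟩
      · obtain ⟨X, hX⟩ : ∃ X, X ∈ L := List.exists_mem_of_length_pos (by omega)
        obtain ⟨x, hx⟩ := (hL' X hX).1.nonempty
        obtain ⟨y, hy⟩ := hY.nonempty
        have hxU := (hL' X hX).2 hx
        obtain ⟨a, ha, b, hb, haA, hbA, hab⟩ := hU.cut {u | ∃ y ∈ Y, Near G y u} (hYU hy)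
          ⟨y, hy, .refl y⟩ hxU fun h' => h ⟨x, hxU, h', X, hX, x, hx, .refl x⟩
        obtain ⟨X', hX', x', hx', hn⟩ := hdom b hb
        rcases List.mem_cons.1 hX' with rfl | hX'
        · exact absurd ⟨x', hx', hn⟩ hbA
        · exact ⟨X', hX', a, b, ha, hb, haA, .inr hab, x', hx', hn⟩
    obtain ⟨hY', hY'U⟩ := hL' Y' hY'L
    have hN : Conn G (insert a Y ∪ insert b Y') :=
      (hY.insert_of_near hy hya).union (hY'.insert_of_near hy' hyb) (by simp) (by simp) hab
    have hperm := List.perm_cons_erase hY'L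
    obtain ⟨S, hSU, hS, hSdom, hcard⟩ := ih ((insert a Y ∪ insert b Y') :: L.erase Y')
      (by rw [← hLm, hperm.length_eq]; simp) (by
        intro X hX
        rcases List.mem_cons.1 hX with rfl | hX
        · refine ⟨hN, ?_⟩
          simp [Finset.union_subset_iff, Finset.insert_subset_iff, ha, hb, hYU, hY'U]
        · exact hL' X (List.mem_of_mem_erase hX)) (by
        intro u hu
        obtain ⟨X, hX, x, hx, hn⟩ := hdom u hu
        rw [List.mem_cons, hperm.mem_iff, List.mem_cons] at hX
        rcases hX with rfl | rfl | hX
        · exact ⟨_, List.mem_cons_self, x, by simp [hx], hn⟩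
        · exact ⟨_, List.mem_cons_self, x, by simp [hx], hn⟩
        · exact ⟨X, by simp [hX], x, hx, hn⟩)
    refine ⟨S, hSU, hS, hSdom, hcard.trans ?_⟩
    have h1 := Finset.card_union_le (insert a Y) (insert b Y')
    have h2 := Finset.card_insert_le a Y
    have h3 := Finset.card_insert_le b Y'
    have h4 := (hperm.map Finset.card).sum_eq
    simp only [List.map_cons, List.sum_cons] at h4 ⊢
    omega

end Graph

/-! ### The domination core -/

/-- `M` is an adjacency matrix of `G`.  As entries outside the matrix are read as `false`, vertices
without a row are isolated. -/
def IsAdjMatrix (M : List (List Bool)) (G : SimpleGraph ℕ) : Prop :=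
  ∀ u v, adj M u v = true ↔ G.Adj u v

/-- There are no `d + d` vertices that span a complete bipartite graph. -/
def NoBiclique (d : ℕ) (G : SimpleGraph ℕ) : Prop :=
  ∀ A B : Finset ℕ, A.card = d → B.card = d → ¬∀ a ∈ A, ∀ b ∈ B, G.Adj a b

variable {M : List (List Bool)} {G : SimpleGraph ℕ}

theorem IsAdjMatrix.near_iff (hM : IsAdjMatrix M G) (u v : ℕ) : near M u v = true ↔ Near G u v := by
  simp [near, Near, hM u v]

theorem IsAdjMatrix.dominates_iff (hM : IsAdjMatrix M G) (X : List ℕ) (z : ℕ) :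
    dominates M X z = true ↔ ∃ x ∈ X, Near G x z := by
  simp [dominates, hM.near_iff]

theorem nodup_verts (M : List (List Bool)) : (verts M).Nodup := List.nodup_range

/-- A set of `2 * d` common closed neighbours of `d` vertices yields a biclique. -/
theorem NoBiclique.length_lt {d : ℕ} (hG : NoBiclique d G) {A W : List ℕ} (hA : A.Nodup)
    (hW : W.Nodup) (hAd : A.length = d) (h : ∀ a ∈ A, ∀ w ∈ W, Near G a w) : W.length < 2 * d := by
  by_contra hlt
  have h1 := Finset.le_card_sdiff A.toFinset W.toFinset
  rw [List.toFinset_card_of_nodup hA, List.toFinset_card_of_nodup hW] at h1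
  obtain ⟨B, hB, hBd⟩ := Finset.exists_subset_card_eq (n := d) (s := W.toFinset \ A.toFinset)
    (by omega)
  refine hG A.toFinset B (by rw [List.toFinset_card_of_nodup hA, hAd]) hBd fun a ha b hb => ?_
  have hb' := hB hb
  simp only [Finset.mem_sdiff, List.mem_toFinset] at hb' ha
  rcases h a ha b hb'.1 with rfl | h
  · exact absurd ha hb'.2
  · exact h

/-- The set where `concentrate` stops has at least two elements, and outside a set `A'` of common
closed neighbours no vertex covers the fraction `1 / r` of it: `d` common closed neighbours would
yield a biclique. -/
theorem concentrate_spec (hM : IsAdjMatrix M G) {d r : ℕ} (hd : 1 ≤ d) (hr : 1 ≤ r)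
    (hG : NoBiclique d G) (i : ℕ) (A W : List ℕ) (hA : A.Nodup) (hW : W.Nodup)
    (hAi : A.length + i = d) (hAW : ∀ a ∈ A, ∀ w ∈ W, Near G a w) (hcard : 2 * d * r ^ i ≤ W.length) :
    (concentrate M r i A W).Sublist W ∧ 2 ≤ (concentrate M r i A W).length ∧
      ∃ A' : List ℕ, (∀ a ∈ A', ∀ w ∈ concentrate M r i A W, Near G a w) ∧
        ∀ v ∈ verts M, v ∉ A' → r * ((concentrate M r i A W).filter fun w => near M v w).length <
          (concentrate M r i A W).length := by
  induction i generalizing A W with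
  | zero =>
    have := hG.length_lt hA hW (by simpa using hAi) hAW
    simp at hcard
    omega
  | succ i ih =>
    rw [concentrate]
    set c := (verts M).filter fun v =>
      !A.contains v && decide (W.length ≤ r * (W.filter fun w => near M v w).length) with hc
    cases hcl : c with
    | nil =>
      refine ⟨.refl _, ?_, A, hAW, fun v hv hvA => ?_⟩
      · have : 1 ≤ r ^ (i + 1) := Nat.one_le_pow _ _ hr
        refine le_trans ?_ hcard
        nlinarith
      · have : v ∉ c := by simp [hcl]
        rw [hc, List.mem_filter] at this
        simp only [hv, true_and, Bool.and_eq_true, Bool.not_eq_true', decide_eq_true_eq, not_and,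
          not_le, List.contains_eq_mem, decide_eq_false_iff_not] at this
        exact this hvA
    | cons v l =>
      have hv : v ∈ c := by simp [hcl]
      rw [hc, List.mem_filter] at hv
      simp only [Bool.and_eq_true, Bool.not_eq_true', decide_eq_true_eq,
        List.contains_eq_mem, decide_eq_false_iff_not] at hv
      obtain ⟨-, hvA, hvW⟩ := hv
      obtain ⟨h1, h2, A', h3, h4⟩ := ih (v :: A) (W.filter fun w => near M v w)
        (List.nodup_cons.2 ⟨hvA, hA⟩) (hW.filter _) (by simp; omega) (by
          intro a ha w hw
          rw [List.mem_filter] at hw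
          rcases List.mem_cons.1 ha with rfl | ha
          · exact (hM.near_iff _ _).1 hw.2
          · exact hAW a ha w hw.1) (by
          have := hcard.trans hvW
          rw [pow_succ, ← mul_assoc, mul_comm r] at this
          exact Nat.le_of_mul_le_mul_right this hr)
      exact ⟨h1.trans List.filter_sublist, h2, A', h3, h4⟩

theorem headD_concentrate_mem (hM : IsAdjMatrix M G) {d r : ℕ} (hd : 1 ≤ d) (hr : 1 ≤ r)
    (hG : NoBiclique d G) {Z : List ℕ} (hZ : Z.Nodup) (hcard : 2 * d * r ^ d ≤ Z.length) :
    (concentrate M r d [] Z).headD 0 ∈ concentrate M r d [] Z ∧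
      (concentrate M r d [] Z).headD 0 ∈ Z := by
  obtain ⟨hsub, htwo, -⟩ := concentrate_spec hM hd hr hG d [] Z
    List.nodup_nil hZ (by simp) (by simp) hcard
  cases h : concentrate M r d [] Z with
  | nil => simp [h] at htwo
  | cons z W' =>
    have hz : z ∈ concentrate M r d [] Z := by simp [h]
    exact ⟨by simp, by simpa using hsub.subset hz⟩

/-- The vertex that is deleted from a large set is dominated by every set of less than `r` vertices
that dominates the rest. -/
theorem exists_near_headD_concentrate (hM : IsAdjMatrix M G) {d r : ℕ} (hd : 1 ≤ d)
    (hG : NoBiclique d G) {Z : List ℕ} (hZ : Z.Nodup) (hcard : 2 * d * r ^ d ≤ Z.length)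
    {D : Finset ℕ} (hD : ∀ v ∈ D, v ∈ verts M) (hDr : D.card < r)
    (hdom : ∀ z ∈ Z, z ≠ (concentrate M r d [] Z).headD 0 → ∃ x ∈ D, Near G x z) :
    ∃ x ∈ D, Near G x ((concentrate M r d [] Z).headD 0) := by
  have hz := (headD_concentrate_mem hM hd (by omega : 1 ≤ r) hG hZ hcard).1
  obtain ⟨hsub, htwo, A, hA, hsmall⟩ := concentrate_spec hM hd (by omega : 1 ≤ r) hG d [] Z
    List.nodup_nil hZ (by simp) (by simp) hcard
  set W := concentrate M r d [] Z with hW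
  set z := W.headD 0
  by_contra hno
  have hWn : W.Nodup := hZ.sublist hsub
  have hcover : W.toFinset.erase z ⊆
      D.biUnion fun v => (W.filter fun w => near M v w).toFinset := by
    intro w hw
    simp only [Finset.mem_erase, List.mem_toFinset] at hw
    obtain ⟨x, hx, hn⟩ := hdom w (hsub.subset hw.2) hw.1
    simp only [Finset.mem_biUnion, List.mem_toFinset, List.mem_filter]
    exact ⟨x, hx, hw.2, (hM.near_iff _ _).2 hn⟩
  have h1 := (Finset.card_le_card hcover).trans Finset.card_biUnion_le
  rw [Finset.card_erase_of_mem (by simpa using hz), List.toFinset_card_of_nodup hWn] at h1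
  have h2 : r * ∑ v ∈ D, (W.filter fun w => near M v w).toFinset.card ≤
      D.card * (W.length - 1) := by
    rw [Finset.mul_sum, ← smul_eq_mul]
    refine Finset.sum_le_card_nsmul _ _ _ fun v hv => ?_
    rw [List.toFinset_card_of_nodup (hWn.filter _)]
    have hvA : v ∉ A := fun h => hno ⟨v, hv, hA v h z hz⟩
    have := hsmall v (hD v hv) hvA
    omega
  have h3 := (Nat.mul_le_mul_left r h1).trans h2
  have := Nat.le_of_mul_le_mul_right h3 (by omega)
  omega

/-- The core has at most `B` vertices, and every set of less than `r` vertices that dominates the core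
dominates the graph. -/
theorem core_spec (hM : IsAdjMatrix M G) {d r B : ℕ} (hd : 1 ≤ d) (hr : 1 ≤ r)
    (hG : NoBiclique d G)
    (hB : 2 * d * r ^ d ≤ B) :
    (core M d r B).Nodup ∧ (∀ z ∈ core M d r B, z ∈ verts M) ∧ (core M d r B).length ≤ B ∧
      ∀ D : Finset ℕ, (∀ v ∈ D, v ∈ verts M) → D.card < r →
        Dominates G D (core M d r B).toFinset → Dominates G D (verts M).toFinset := by
  have key : ∀ P Z : List ℕ, (Z ++ P).Nodup → Z.length ≤ B →
      (∀ z ∈ P.foldl (fun Z v => coreStep M d r B Z v) Z, z ∈ Z ++ P) ∧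
      (P.foldl (fun Z v => coreStep M d r B Z v) Z).Nodup ∧
      (P.foldl (fun Z v => coreStep M d r B Z v) Z).length ≤ B ∧
      ∀ D : Finset ℕ, (∀ v ∈ D, v ∈ verts M) → D.card < r →
        Dominates G D (P.foldl (fun Z v => coreStep M d r B Z v) Z).toFinset →
        Dominates G D (Z ++ P).toFinset := by
    intro P
    induction P with
    | nil => intro Z h1 h2; simpa using ⟨by simpa using h1, h2⟩
    | cons v P ih =>
      intro Z hnd hZ
      have hperm : (Z ++ v :: P).Perm (v :: Z ++ P) := List.perm_middle
      have hnd' := hperm.nodup_iff.1 hnd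
      have hvZ : (v :: Z).Nodup := (List.nodup_append.1 hnd').1
      have hsub : (coreStep M d r B Z v).Sublist (v :: Z) := by
        unfold coreStep
        rw [Bool.cond_eq_ite]
        split_ifs
        · exact .refl _
        · exact List.filter_sublist
      have hstep : (coreStep M d r B Z v).length ≤ B ∧
          ∀ D : Finset ℕ, (∀ v ∈ D, v ∈ verts M) → D.card < r →
          Dominates G D (coreStep M d r B Z v).toFinset → Dominates G D (v :: Z).toFinset := by
        by_cases hle : (v :: Z).length ≤ B
        · have : coreStep M d r B Z v = v :: Z := by simp only [coreStep, hle, decide_true, cond_true]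
          rw [this]
          exact ⟨hle, fun D _ _ h => h⟩
        · have hcs : coreStep M d r B Z v =
              (v :: Z).filter fun x => !(x == (concentrate M r d [] (v :: Z)).headD 0) := by
            simp only [coreStep, hle, decide_false, cond_false]
          have hmem := (headD_concentrate_mem hM hd hr hG hvZ (by omega)).2
          have hnear := fun D => exists_near_headD_concentrate (r := r) (D := D) hM hd hG hvZ (by omega)
          rw [hcs]
          generalize (concentrate M r d [] (v :: Z)).headD 0 = z at hmem hnear ⊢
          constructor
          · have hlt : ((v :: Z).filter fun x => !(x == z)).length < (v :: Z).length :=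
              List.length_filter_lt_length_iff_exists.2 ⟨z, hmem, by simp⟩
            rw [List.length_cons] at hlt
            omega
          · intro D hD hDr hdom y hy
            by_cases hyz : y = z
            · rw [hyz]
              refine hnear D hD hDr fun y hy hne => hdom y ?_
              rw [List.mem_toFinset, List.mem_filter]
              exact ⟨hy, by simpa using hne⟩
            · refine hdom y ?_
              rw [List.mem_toFinset, List.mem_filter]
              exact ⟨by simpa using hy, by simpa using hyz⟩
      obtain ⟨h1, h2, h3, h4⟩ := ih (coreStep M d r B Z v)
        (hnd'.sublist (hsub.append (.refl P))) hstep.1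
      refine ⟨fun z hz => ?_, h2, h3, fun D hD hDr hdom => ?_⟩
      · exact hperm.mem_iff.2 ((hsub.append (.refl P)).subset (h1 z hz))
      · have h5 := h4 D hD hDr hdom
        have h6 := hstep.2 D hD hDr fun y hy => h5 y (by simp at hy ⊢; exact .inl hy)
        intro y hy
        rw [List.mem_toFinset, hperm.mem_iff, List.mem_append] at hy
        rcases hy with hy | hy
        · exact h6 y (by simpa using hy)
        · exact h5 y (by simp [hy])
  obtain ⟨h1, h2, h3, h4⟩ := key (verts M) [] (by simpa using nodup_verts M) (by simp)
  exact ⟨h2, h1, h3, h4⟩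

variable {M : List (List Bool)} {G : SimpleGraph ℕ}

/-! ### Correctness of the connectivity test -/

theorem connected_iff (hM : IsAdjMatrix M G) (X : List ℕ) :
    connected M X = true ↔ Conn G X.toFinset := by
  cases hX : X with
  | nil => simpa [connected] using fun h : Conn G ∅ => by simpa using h.nonempty
  | cons x₀ l =>
    rw [← hX]
    have hx₀ : x₀ ∈ X := by simp [hX]
    have htake : X.take 1 = [x₀] := by simp [hX]
    set f : List ℕ → List ℕ := fun R => X.filter fun y => dominates M R y with hf
    have hmem : ∀ R y, y ∈ f R ↔ y ∈ X ∧ ∃ x ∈ R, Near G x y := by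
      intro R y
      rw [hf, List.mem_filter, hM.dominates_iff]
    have hsub : ∀ i, ∀ y ∈ f^[i] [x₀], y ∈ X := by
      intro i y hy
      cases i with
      | zero => simp at hy; rwa [hy]
      | succ i =>
        rw [Function.iterate_succ_apply', hmem] at hy
        exact hy.1
    have hconn : connected M X = true ↔ ∀ x ∈ X, x ∈ f^[X.length] [x₀] := by
      unfold connected
      rw [htake]
      simp [List.ne_nil_of_mem hx₀, hf]
    rw [hconn]
    constructor
    · intro h
      refine conn_iff_cut.2 ⟨⟨x₀, by simpa using hx₀⟩, ?_⟩
      rintro A ⟨a, ha, haA⟩ ⟨b, hb, hbA⟩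
      rw [List.mem_toFinset] at ha hb
      by_contra hno
      push Not at hno
      simp only [List.mem_toFinset] at hno
      have key : ∀ i, ∀ y ∈ f^[i] [x₀], (y ∈ A ↔ x₀ ∈ A) := by
        intro i
        induction i with
        | zero => intro y hy; simp at hy; rw [hy]
        | succ i ih =>
          intro y hy
          rw [Function.iterate_succ_apply', hmem] at hy
          obtain ⟨hyX, x, hx, hn⟩ := hy
          rw [← ih x hx]
          rcases hn with rfl | hn
          · rfl
          · have hxX := hsub i x hx
            constructor
            · exact fun h => by_contra fun h' => hno y hyX x hxX h h' hn.symm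
            · exact fun h => by_contra fun h' => hno x hxX y hyX h h' hn
      exact hbA (((key _ b (h b hb)).trans (key _ a (h a ha)).symm).2 haA)
    · intro h
      have hx₀i : ∀ i, x₀ ∈ f^[i] [x₀] := by
        intro i
        induction i with
        | zero => simp
        | succ i ih =>
          rw [Function.iterate_succ_apply', hmem]
          exact ⟨hx₀, x₀, ih, .refl _⟩
      have hcard : ∀ i, min (i + 1) X.toFinset.card ≤ (f^[i] [x₀]).toFinset.card := by
        intro i
        induction i with
        | zero => simp
        | succ i ih =>
          have hmono : (f^[i] [x₀]).toFinset ⊆ (f^[i + 1] [x₀]).toFinset := by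
            intro y hy
            rw [List.mem_toFinset] at hy ⊢
            rw [Function.iterate_succ_apply', hmem]
            exact ⟨hsub i y hy, y, hy, .refl _⟩
          by_cases hall : ∀ x ∈ X, x ∈ f^[i] [x₀]
          · refine (min_le_right _ _).trans ((Finset.card_le_card ?_).trans
              (Finset.card_le_card hmono))
            intro x hx
            simpa using hall x (by simpa using hx)
          · push Not at hall
            obtain ⟨b, hb, hbR⟩ := hall
            obtain ⟨x, hx, y, hy, hxR, hyR, hxy⟩ := h.cut {x | x ∈ f^[i] [x₀]}
              (by simpa using hx₀) (hx₀i i) (by simpa using hb) hbR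
            have hlt : (f^[i] [x₀]).toFinset.card < (f^[i + 1] [x₀]).toFinset.card := by
              refine Finset.card_lt_card ⟨hmono, fun hsup => hyR ?_⟩
              have : y ∈ (f^[i + 1] [x₀]).toFinset := by
                rw [List.mem_toFinset, Function.iterate_succ_apply', hmem]
                exact ⟨by simpa using hy, x, hxR, .inr hxy⟩
              simpa using hsup this
            omega
      have hfull : (f^[X.length] [x₀]).toFinset = X.toFinset := by
        refine Finset.eq_of_subset_of_card_le (fun y hy => ?_) (le_trans ?_ (hcard _))
        · simpa using hsub _ y (by simpa using hy)
        · have := List.toFinset_card_le X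
          omega
      intro x hx
      rw [← List.mem_toFinset, hfull, List.mem_toFinset]
      exact hx

/-! ### Representatives of connected pieces -/

theorem mem_tuples (j : ℕ) (X : List ℕ) :
    X ∈ tuples M j ↔ X.length = j ∧ ∀ x ∈ X, x ∈ verts M := by
  induction j generalizing X with
  | zero => simp +contextual [tuples, List.length_eq_zero_iff]
  | succ j ih =>
    simp only [tuples, List.mem_flatMap, List.mem_map, ih]
    constructor
    · rintro ⟨v, hv, Y, ⟨hY, hY'⟩, rfl⟩
      simpa [hY, hv] using hY'
    · rintro ⟨h1, h2⟩
      cases X with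
      | nil => simp at h1
      | cons v Y =>
        exact ⟨v, h2 v (by simp), Y, ⟨by simpa using h1, fun x hx => h2 x (by simp [hx])⟩, rfl⟩

theorem sameTrace_iff (M : List (List Bool)) (Z X Y : List ℕ) :
    sameTrace M Z X Y = true ↔ ∀ z ∈ Z, (dominates M X z ↔ dominates M Y z) := by
  unfold sameTrace
  rw [List.all_eq_true]
  refine forall₂_congr fun z _ => ?_
  rw [beq_iff_eq, Bool.eq_iff_iff]

theorem representatives_spec (M : List (List Bool)) (Z : List ℕ) (L : List (List ℕ)) :
    (∀ X ∈ representatives M Z L, X ∈ L) ∧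
    (∀ X ∈ L, ∃ Y ∈ representatives M Z L, sameTrace M Z X Y = true) ∧
    (representatives M Z L).Pairwise fun X Y => ¬sameTrace M Z X Y = true := by
  have key : ∀ (L acc : List (List ℕ)), acc.Pairwise (fun X Y => ¬sameTrace M Z X Y = true) →
      let R := L.foldl (fun acc X =>
        bif acc.any (fun Y => sameTrace M Z X Y) then acc else X :: acc) acc
      (∀ X ∈ R, X ∈ acc ∨ X ∈ L) ∧ (∀ X ∈ acc, X ∈ R) ∧
      (∀ X ∈ L, ∃ Y ∈ R, sameTrace M Z X Y = true) ∧
      R.Pairwise fun X Y => ¬sameTrace M Z X Y = true := by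
    intro L
    induction L with
    | nil => intro acc hacc; simpa using hacc
    | cons X L ih =>
      intro acc hacc
      rw [List.foldl_cons]
      cases h : acc.any (fun Y => sameTrace M Z X Y) with
      | true =>
        obtain ⟨h1, h2, h3, h4⟩ := ih acc hacc
        refine ⟨fun Y hY => ?_, h2, fun Y hY => ?_, h4⟩
        · rcases h1 Y hY with h | h <;> simp [h]
        · rcases List.mem_cons.1 hY with rfl | hY
          · obtain ⟨W, hW, hYW⟩ := List.any_eq_true.1 h
            exact ⟨W, h2 W hW, hYW⟩
          · exact h3 Y hY
      | false =>
        obtain ⟨h1, h2, h3, h4⟩ := ih (X :: acc) (by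
          rw [List.pairwise_cons]
          exact ⟨by simpa using List.any_eq_false.1 h, hacc⟩)
        refine ⟨fun Y hY => ?_, fun Y hY => h2 Y (by simp [hY]), fun Y hY => ?_, h4⟩
        · rcases h1 Y hY with h | h
          · rcases List.mem_cons.1 h with rfl | h <;> simp [*]
          · simp [h]
        · rcases List.mem_cons.1 hY with rfl | hY
          · exact ⟨Y, h2 Y (by simp), (sameTrace_iff _ _ _ _).2 fun _ _ => Iff.rfl⟩
          · exact h3 Y hY
  obtain ⟨h1, -, h3, h4⟩ := key L [] List.Pairwise.nil
  exact ⟨fun X hX => (h1 X hX).resolve_left (by simp), h3, h4⟩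

theorem mem_pieces (hM : IsAdjMatrix M G) (Z : List ℕ) (j : ℕ) (X : List ℕ)
    (hX : X ∈ pieces M Z j) :
    Conn G X.toFinset ∧ (∀ x ∈ X, x ∈ verts M) ∧ X.length ≤ j := by
  induction j with
  | zero => simp [pieces] at hX
  | succ j ih =>
    rw [pieces, List.mem_append] at hX
    rcases hX with hX | hX
    · have := (representatives_spec M Z _).1 X hX
      rw [List.mem_filter, mem_tuples, connected_iff hM] at this
      exact ⟨this.2, this.1.2, this.1.1.le⟩
    · obtain ⟨h1, h2, h3⟩ := ih hX
      exact ⟨h1, h2, h3.trans (Nat.le_succ j)⟩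

/-- Every connected set of at most `j` vertices is replaced by a representative that is not larger and
dominates the same vertices of `Z`. -/
theorem exists_mem_pieces (hM : IsAdjMatrix M G) (Z : List ℕ) (j : ℕ) {S : Finset ℕ}
    (hS : Conn G S) (hSv : ∀ x ∈ S, x ∈ verts M) (hcard : S.card ≤ j) :
    ∃ Y ∈ pieces M Z j, Y.toFinset.card ≤ S.card ∧
      ∀ z ∈ Z, (∃ x ∈ S, Near G x z) → ∃ y ∈ Y, Near G y z := by
  induction j with
  | zero =>
    have := Finset.card_pos.2 hS.nonempty
    omega
  | succ j ih =>
    simp only [pieces, List.mem_append]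
    rcases Nat.lt_or_ge j S.card with hlt | hle
    · have hmem : S.toList ∈ (tuples M (j + 1)).filter fun X => connected M X := by
        rw [List.mem_filter, mem_tuples, connected_iff hM]
        have : S.card = j + 1 := by omega
        simpa [hS] using ⟨this, hSv⟩
      obtain ⟨h1, h2, -⟩ := representatives_spec M Z
        ((tuples M (j + 1)).filter fun X => connected M X)
      obtain ⟨Y, hY, hSY⟩ := h2 _ hmem
      refine ⟨Y, .inl hY, ?_, fun z hz hn => ?_⟩
      · have := h1 Y hY
        rw [List.mem_filter, mem_tuples] at this
        have h3 := List.toFinset_card_le Y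
        omega
      · have := (sameTrace_iff _ _ _ _).1 hSY z hz
        rw [hM.dominates_iff, hM.dominates_iff] at this
        exact this.1 (by simpa using hn)
    · obtain ⟨Y, hY, h⟩ := ih hle
      exact ⟨Y, .inr hY, h⟩

/-! ### The number of representatives -/

/-- The closed neighbours of `v` in `Z`. -/
def trace (M : List (List Bool)) (Z : List ℕ) (v : ℕ) : Finset ℕ :=
  Z.toFinset.filter fun z => near M v z = true

/-- The closed neighbourhoods of vertices, restricted to `Z`. -/
def traces (M : List (List Bool)) (Z : List ℕ) : Finset (Finset ℕ) :=
  (verts M).toFinset.image (trace M Z)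

theorem card_filter_powerset_card_le (S : Finset ℕ) (d : ℕ) :
    (S.powerset.filter fun T => T.card ≤ d).card ≤ (S.card + 1) ^ d := by
  classical
  have h : S.powerset.filter (fun T => T.card ≤ d) ⊆
      (Finset.univ : Finset (Fin d → Option S)).image
        fun f => Finset.univ.biUnion fun i => ((f i).map Subtype.val).toFinset := by
    intro T hT
    simp only [Finset.mem_filter, Finset.mem_powerset] at hT
    simp only [Finset.mem_image, Finset.mem_univ, true_and]
    refine ⟨fun i => if h : i < T.card then
      some ⟨T.equivFin.symm ⟨i, h⟩, hT.1 (Subtype.prop _)⟩ else none, ?_⟩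
    ext x
    simp only [Finset.mem_biUnion, Finset.mem_univ, true_and, Option.mem_toFinset, Option.mem_def,
      Option.map_eq_some_iff]
    constructor
    · rintro ⟨i, y, hy, rfl⟩
      split_ifs at hy with h
      simp only [Option.some.injEq] at hy
      rw [← hy]
      exact (T.equivFin.symm ⟨i, h⟩).2
    · intro hx
      have hlt : (T.equivFin ⟨x, hx⟩ : ℕ) < T.card := (T.equivFin ⟨x, hx⟩).2
      refine ⟨⟨T.equivFin ⟨x, hx⟩, by omega⟩, ⟨x, hT.1 hx⟩, ?_, rfl⟩
      simp
  refine (Finset.card_le_card h).trans (Finset.card_image_le.trans ?_)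
  simp

/-- In a graph without `K_{d,d}`, the number of traces on `Z` is polynomial in `|Z|`: there are few
traces of elements of `Z`, few sets of less than `d` elements, and every `d` elements of `Z` have less
than `d` common neighbours outside `Z`. -/
theorem card_traces_le (hM : IsAdjMatrix M G) {d : ℕ} (hG : NoBiclique d G) (Z : List ℕ) :
    (traces M Z).card ≤ Z.length + (Z.length + 1) ^ d + d * Z.length ^ d := by
  classical
  set S := Z.toFinset with hS
  have hSZ : S.card ≤ Z.length := List.toFinset_card_le Z
  set big := (verts M).toFinset.filter fun v => v ∉ S ∧ d ≤ (trace M Z v).card with hbig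
  have hsub : traces M Z ⊆ S.image (trace M Z) ∪ (S.powerset.filter fun T => T.card ≤ d) ∪
      big.image (trace M Z) := by
    intro T hT
    obtain ⟨v, hv, rfl⟩ := Finset.mem_image.1 hT
    simp only [Finset.mem_union, Finset.mem_image, Finset.mem_filter, Finset.mem_powerset, hbig]
    by_cases hvS : v ∈ S
    · exact .inl (.inl ⟨v, hvS, rfl⟩)
    · rcases Nat.le_total (trace M Z v).card d with h | h
      · exact .inl (.inr ⟨Finset.filter_subset _ _, h⟩)
      · exact .inr ⟨v, ⟨hv, hvS, h⟩, rfl⟩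
  have hbigcard : big.card ≤ d * Z.length ^ d := by
    have hex : ∀ v, ∃ T, v ∈ big → T ⊆ trace M Z v ∧ T.card = d := by
      intro v
      by_cases hv : v ∈ big
      · rw [hbig, Finset.mem_filter] at hv
        obtain ⟨T, h1, h2⟩ := Finset.exists_subset_card_eq hv.2.2
        exact ⟨T, fun _ => ⟨h1, h2⟩⟩
      · exact ⟨∅, fun h => absurd h hv⟩
    choose t ht using hex
    have hmaps : ∀ v ∈ big, t v ∈ S.powersetCard d := by
      intro v hv
      rw [Finset.mem_powersetCard]
      exact ⟨(ht v hv).1.trans (Finset.filter_subset _ _), (ht v hv).2⟩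
    refine (Finset.card_le_mul_card_image_of_maps_to hmaps d fun T hT => ?_).trans ?_
    · by_contra hlt
      obtain ⟨A, hA, hAd⟩ := Finset.exists_subset_card_eq (n := d) (le_of_not_ge hlt)
      refine hG A T hAd (Finset.mem_powersetCard.1 hT).2 fun a ha b hb => ?_
      have ha' := Finset.mem_filter.1 (hA ha)
      have hb' := (ht a ha'.1).1 (ha'.2 ▸ hb)
      rw [trace, Finset.mem_filter, hM.near_iff] at hb'
      rcases hb'.2 with rfl | h
      · have := ha'.1
        rw [hbig, Finset.mem_filter] at this
        exact absurd hb'.1 this.2.1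
      · exact h
    · rw [Finset.card_powersetCard]
      gcongr
      exact (Nat.choose_le_pow _ _).trans (Nat.pow_le_pow_left hSZ d)
  calc (traces M Z).card
      ≤ (S.image (trace M Z)).card + (S.powerset.filter fun T => T.card ≤ d).card +
          (big.image (trace M Z)).card :=
        (Finset.card_le_card hsub).trans ((Finset.card_union_le _ _).trans
          (Nat.add_le_add_right (Finset.card_union_le _ _) _))
    _ ≤ Z.length + (Z.length + 1) ^ d + d * Z.length ^ d := by
        gcongr
        · exact Finset.card_image_le.trans hSZ
        · exact (card_filter_powerset_card_le S d).trans (by gcongr)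
        · exact Finset.card_image_le.trans hbigcard

/-- The vertices of `Z` that a set dominates are determined by the traces of its elements. -/
theorem length_representatives_le (Z : List ℕ) (j : ℕ) (L : List (List ℕ))
    (hL : ∀ X ∈ L, X ∈ tuples M j) : (representatives M Z L).length ≤ (traces M Z).card ^ j := by
  classical
  obtain ⟨h1, -, h3⟩ := representatives_spec M Z L
  have hnd : (representatives M Z L).Nodup := h3.imp fun {X Y} h (heq : X = Y) =>
    h (heq ▸ (sameTrace_iff _ _ _ _).2 fun _ _ => Iff.rfl)
  rw [← List.toFinset_card_of_nodup hnd]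
  have hT : (Fintype.piFinset fun _ : Fin j => traces M Z).card = (traces M Z).card ^ j := by simp
  rw [← hT]
  have hlen : ∀ X ∈ representatives M Z L, X.length = j ∧ ∀ x ∈ X, x ∈ verts M :=
    fun X hX => (mem_tuples j X).1 (hL X (h1 X hX))
  refine Finset.card_le_card_of_injOn (fun X i => trace M Z (X.getD i 0)) ?_ ?_
  · intro X hX
    obtain ⟨hXj, hXv⟩ := hlen X (by simpa using hX)
    simp only [Finset.mem_coe, Fintype.mem_piFinset]
    intro i
    refine Finset.mem_image_of_mem _ ?_
    rw [List.mem_toFinset, List.getD_eq_getElem _ _ (by omega)]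
    exact hXv _ (List.getElem_mem _)
  · intro X hX Y hY hXY
    have hX' : X ∈ representatives M Z L := by simpa using hX
    have hY' : Y ∈ representatives M Z L := by simpa using hY
    obtain ⟨hXj, -⟩ := hlen X hX'
    obtain ⟨hYj, -⟩ := hlen Y hY'
    by_contra hne
    have hhalf : ∀ X Y : List ℕ, X.length = j → Y.length = j →
        (∀ i : Fin j, trace M Z (X.getD i 0) = trace M Z (Y.getD i 0)) →
        ∀ z ∈ Z, dominates M X z = true → dominates M Y z = true := by
      intro X Y hX hY h z hz hd
      simp only [dominates, List.any_eq_true] at hd ⊢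
      obtain ⟨x, hx, hn⟩ := hd
      obtain ⟨i, hi, rfl⟩ := List.getElem_of_mem hx
      have h' := h ⟨i, by omega⟩
      simp only [List.getD_eq_getElem _ _ hi,
        List.getD_eq_getElem _ _ (show i < Y.length by omega)] at h'
      have hmem : z ∈ trace M Z X[i] := by simp [trace, hz, hn]
      rw [h', trace, Finset.mem_filter] at hmem
      exact ⟨_, List.getElem_mem _, hmem.2⟩
    have hsame : sameTrace M Z X Y = true := (sameTrace_iff _ _ _ _).2 fun z hz =>
      ⟨hhalf X Y hXj hYj (congrFun hXY) z hz,
        hhalf Y X hYj hXj (fun i => (congrFun hXY i).symm) z hz⟩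
    have hsymm : Std.Symm fun X Y => ¬sameTrace M Z X Y = true := ⟨fun X Y h h' => h
      ((sameTrace_iff _ _ _ _).2 fun z hz => ((sameTrace_iff _ _ _ _).1 h' z hz).symm)⟩
    exact h3.forall hX' hY' hne hsame

theorem length_pieces_le (Z : List ℕ) (j : ℕ) :
    (pieces M Z j).length ≤ j * (traces M Z).card.succ ^ j := by
  induction j with
  | zero => simp [pieces]
  | succ j ih =>
    rw [pieces, List.length_append, add_mul, add_comm]
    gcongr ?_ + ?_
    · exact ih.trans (by gcongr <;> simp)
    · rw [one_mul]
      exact (length_representatives_le Z (j + 1) _ fun X hX => (List.mem_filter.1 hX).1).trans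
        (by gcongr; simp)

variable {M : List (List Bool)} {G : SimpleGraph ℕ}

/-! ### The kernel -/

theorem link_cases (hM : IsAdjMatrix M G) (x y : ℕ) :
    (∃ a ∈ verts M, ∃ b ∈ verts M, link M x y = [a, b] ∧ Near G x a ∧ Near G a b ∧ Near G b y) ∨
      link M x y = [] ∧
        ¬∃ a ∈ verts M, ∃ b ∈ verts M, Near G x a ∧ Near G a b ∧ Near G b y := by
  unfold link
  set P := (verts M).flatMap fun a => bif near M x a then
      ((verts M).filter fun b => near M a b && near M b y).map fun b => [a, b] else [] with hP
  have hmem : ∀ l, l ∈ P ↔ ∃ a ∈ verts M, ∃ b ∈ verts M, l = [a, b] ∧ Near G x a ∧ Near G a b ∧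
      Near G b y := by
    intro l
    rw [hP, List.mem_flatMap]
    refine exists_congr fun a => and_congr_right fun _ => ?_
    rw [← hM.near_iff x a]
    cases h : near M x a with
    | false => simp
    | true =>
      simp only [cond_true, List.mem_map, List.mem_filter, Bool.and_eq_true, hM.near_iff]
      constructor
      · rintro ⟨b, ⟨h1, h2, h3⟩, rfl⟩
        exact ⟨b, h1, rfl, trivial, h2, h3⟩
      · rintro ⟨b, h1, rfl, -, h2, h3⟩
        exact ⟨b, ⟨h1, h2, h3⟩, rfl⟩
  cases h : P with
  | nil =>
    refine .inr ⟨by simp, ?_⟩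
    rintro ⟨a, ha, b, hb, h'⟩
    have := (hmem [a, b]).2 ⟨a, ha, b, hb, rfl, h'⟩
    simp [h] at this
  | cons l P' =>
    obtain ⟨a, ha, b, hb, rfl, h'⟩ := (hmem l).1 (by simp [h])
    exact .inl ⟨a, ha, b, hb, by simp, h'⟩

theorem length_links_le (hM : IsAdjMatrix M G) (U : List ℕ) :
    (links M U).length ≤ 2 * U.length ^ 2 := by
  have h1 : ∀ x y, (link M x y).length ≤ 2 := by
    intro x y
    rcases link_cases hM x y with ⟨a, -, b, -, h, -⟩ | ⟨h, -⟩ <;> simp [h]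
  have h2 : ∀ (V : List ℕ) (f : ℕ → List ℕ) (N : ℕ), (∀ y, (f y).length ≤ N) →
      (V.flatMap f).length ≤ V.length * N := by
    intro V f N hf
    induction V with
    | nil => simp
    | cons y V ih =>
      have := hf y
      simp only [List.flatMap_cons, List.length_append, List.length_cons, add_mul, one_mul]
      omega
  refine (h2 _ _ _ fun x => h2 U _ _ fun y => h1 x y).trans (le_of_eq (by ring))

theorem mem_linkedSeed (d s k v : ℕ) : v ∈ linkedSeed d s M k ↔
    v ∈ verts M ∧ (v ∈ seed d s M k ∨ v ∈ links M (seed d s M k)) := by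
  simp [linkedSeed]

theorem nodup_linkedSeed (d s k : ℕ) : (linkedSeed d s M k).Nodup := (nodup_verts M).filter _

section Kernel

variable {d s k : ℕ}

theorem mem_verts_of_mem_seed (hM : IsAdjMatrix M G) (hd : 1 ≤ d) (hG : NoBiclique d G) {v : ℕ}
    (hv : v ∈ seed d s M k) : v ∈ verts M := by
  rw [seed, List.mem_append] at hv
  rcases hv with hv | hv
  · exact (core_spec hM hd (by omega) hG le_rfl).2.1 v hv
  · obtain ⟨X, hX, hvX⟩ := List.mem_flatMap.1 hv
    exact (mem_pieces hM _ _ X hX).2.1 v hvX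

theorem mem_linkedSeed_of_mem_seed (hM : IsAdjMatrix M G) (hd : 1 ≤ d) (hG : NoBiclique d G) {v : ℕ}
    (hv : v ∈ seed d s M k) : v ∈ linkedSeed d s M k :=
  (mem_linkedSeed _ _ _ _).2 ⟨mem_verts_of_mem_seed hM hd hG hv, .inl hv⟩

/-- A set of at most `2 * k` vertices that dominates the linked seed dominates the graph. -/
theorem dominates_verts_of_dominates_linkedSeed (hM : IsAdjMatrix M G) (hd : 1 ≤ d)
    (hG : NoBiclique d G) {S : Finset ℕ} (hS : ∀ v ∈ S, v ∈ verts M) (hcard : S.card ≤ 2 * k)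
    (hdom : Dominates G S (linkedSeed d s M k).toFinset) : Dominates G S (verts M).toFinset := by
  refine (core_spec hM hd (by omega) hG (r := 2 * k + 1) le_rfl).2.2.2 S hS (by omega)
    fun z hz => hdom z ?_
  rw [List.mem_toFinset] at hz ⊢
  exact mem_linkedSeed_of_mem_seed hM hd hG (List.mem_append_left _ hz)

/-- A connected dominating set is traded for connected sets within the seed that dominate the graph
together, and have only a few vertices more. -/
theorem exists_dominating_pieces (hM : IsAdjMatrix M G) (hd : 1 ≤ d) (hs : 1 ≤ s)
    (hG : NoBiclique d G) {D : Finset ℕ} (hDv : ∀ v ∈ D, v ∈ verts M) (hD : Conn G D)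
    (hdom : Dominates G D (verts M).toFinset) (hcard : D.card ≤ k) :
    ∃ (L : List (Finset ℕ)) (m : ℕ), L.length = m + 1 ∧
      (∀ X ∈ L, Conn G X ∧ ∀ x ∈ X, x ∈ seed d s M k) ∧
      (∀ v ∈ verts M, ∃ X ∈ L, ∃ x ∈ X, Near G x v) ∧
      (L.map Finset.card).sum ≤ D.card + m ∧ m * s ≤ D.card := by
  obtain ⟨L, m, hm, hL, hLD, hsum, hms⟩ := hD.exists_pieces hs
  obtain ⟨-, hZv, -, hcore⟩ := core_spec hM hd (by omega : 1 ≤ 2 * k + 1) hG le_rfl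
  set Z := core M d (2 * k + 1) (2 * d * (2 * k + 1) ^ d) with hZ
  have hex : ∀ X, ∃ Y : Finset ℕ, X ∈ L → Conn G Y ∧ (∀ y ∈ Y, y ∈ seed d s M k) ∧
      Y.card ≤ X.card ∧ ∀ z ∈ Z, (∃ x ∈ X, Near G x z) → ∃ y ∈ Y, Near G y z := by
    intro X
    by_cases hX : X ∈ L
    · obtain ⟨Y, hY, h1, h2⟩ := exists_mem_pieces hM Z (2 * s) (hL X hX).1
        (fun x hx => hDv x ((hLD x).2 ⟨X, hX, hx⟩)) (hL X hX).2
      refine ⟨Y.toFinset, fun _ => ⟨(mem_pieces hM Z _ Y hY).1, fun y hy => ?_, h1,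
        by simpa using h2⟩⟩
      rw [seed, List.mem_append, List.mem_flatMap]
      exact .inr ⟨Y, hY, by simpa using hy⟩
    · exact ⟨∅, fun h => absurd h hX⟩
  choose f hf using hex
  have hsum' : ((L.map f).map Finset.card).sum ≤ D.card + m := by
    rw [← hsum, List.map_map]
    exact List.sum_le_sum fun X hX => (hf X hX).2.2.1
  refine ⟨L.map f, m, by simpa using hm, ?_, ?_, hsum', hms⟩
  · intro Y hY
    obtain ⟨X, hX, rfl⟩ := List.mem_map.1 hY
    exact ⟨(hf X hX).1, (hf X hX).2.1⟩
  · have hmD : m ≤ D.card := le_trans (Nat.le_mul_of_pos_right m hs) hms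
    have hDcard : (L.toFinset.biUnion f).card ≤ D.card + m := by
      refine Finset.card_biUnion_le.trans (le_trans ?_ hsum')
      rw [List.map_map, Finset.sum_list_map_count]
      refine Finset.sum_le_sum fun X hX => ?_
      have : 1 ≤ L.count X := List.count_pos_iff.2 (by simpa using hX)
      simpa using Nat.le_mul_of_pos_left _ this
    have := hcore (L.toFinset.biUnion f) (by
      intro v hv
      obtain ⟨X, hX, hvX⟩ := Finset.mem_biUnion.1 hv
      exact mem_verts_of_mem_seed hM hd hG ((hf X (by simpa using hX)).2.1 v hvX))
      (by omega) (by
      intro z hz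
      rw [List.mem_toFinset] at hz
      obtain ⟨x, hx, hn⟩ := hdom z (by simpa using hZv z hz)
      obtain ⟨X, hX, hxX⟩ := (hLD x).1 hx
      obtain ⟨y, hy, hyz⟩ := (hf X hX).2.2.2 z hz ⟨x, hxX, hn⟩
      exact ⟨y, Finset.mem_biUnion.2 ⟨X, by simpa using hX, hy⟩, hyz⟩)
    intro v hv
    obtain ⟨y, hy, hn⟩ := this v (by simpa using hv)
    obtain ⟨X, hX, hyX⟩ := Finset.mem_biUnion.1 hy
    exact ⟨f X, List.mem_map_of_mem (by simpa using hX), y, hyX, hn⟩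

/-- If a connected graph is dominated by the seed, then the linked seed is connected. -/
theorem conn_linkedSeed (hM : IsAdjMatrix M G) (hd : 1 ≤ d) (hG : NoBiclique d G)
    (hconn : Conn G (verts M).toFinset)
    (hdom : ∀ v ∈ verts M, ∃ x ∈ seed d s M k, Near G x v) :
    Conn G (linkedSeed d s M k).toFinset := by
  have hlinks : ∀ x ∈ seed d s M k, ∀ y ∈ seed d s M k, ∀ v ∈ link M x y,
      v ∈ links M (seed d s M k) := fun x hx y hy v hv =>
    List.mem_flatMap.2 ⟨x, hx, List.mem_flatMap.2 ⟨y, hy, hv⟩⟩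
  refine conn_of_links (U₀ := (seed d s M k).toFinset) hconn ?_ ?_ ?_ ?_ ?_
  · intro v hv
    simpa using hdom v (by simpa using hv)
  · intro v hv
    rw [List.mem_toFinset] at hv ⊢
    exact mem_linkedSeed_of_mem_seed hM hd hG hv
  · intro v hv
    rw [List.mem_toFinset] at hv ⊢
    exact ((mem_linkedSeed _ _ _ _).1 hv).1
  · intro v hv
    rw [List.mem_toFinset, mem_linkedSeed] at hv
    simpa using hdom v hv.1
  · rintro x hx y hy ⟨a, ha, b, hb, h⟩
    rw [List.mem_toFinset] at hx hy ha hb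
    rcases link_cases hM x y with ⟨a', ha', b', hb', hab, h'⟩ | ⟨-, hno⟩
    · have hl := hlinks x hx y hy
      rw [hab] at hl
      exact ⟨a', by simpa [mem_linkedSeed, ha'] using .inr (hl a' (by simp)), b',
        by simpa [mem_linkedSeed, hb'] using .inr (hl b' (by simp)), h'⟩
    · exact absurd ⟨a, ha, b, hb, h⟩ hno

/-- A connected dominating set `D` of at most `k` vertices yields one of the linked seed that has at
most `3 * |D| / s` vertices more. -/
theorem exists_conn_dominating_linkedSeed (hM : IsAdjMatrix M G) (hd : 1 ≤ d) (hs : 1 ≤ s)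
    (hG : NoBiclique d G) (hconn : Conn G (verts M).toFinset) {D : Finset ℕ}
    (hDv : ∀ v ∈ D, v ∈ verts M) (hD : Conn G D) (hdom : Dominates G D (verts M).toFinset)
    (hcard : D.card ≤ k) :
    Conn G (linkedSeed d s M k).toFinset ∧ ∃ S ⊆ (linkedSeed d s M k).toFinset, Conn G S ∧
      Dominates G S (linkedSeed d s M k).toFinset ∧ ∃ m, m * s ≤ D.card ∧
        S.card ≤ D.card + 3 * m := by
  obtain ⟨L, m, hm, hL, hLdom, hsum, hms⟩ := exists_dominating_pieces hM hd hs hG hDv hD hdom hcard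
  have hU := conn_linkedSeed (s := s) (k := k) hM hd hG hconn (by
    intro v hv
    obtain ⟨X, hX, x, hx, hn⟩ := hLdom v hv
    exact ⟨x, (hL X hX).2 x hx, hn⟩)
  obtain ⟨S, hSU, hS, hSdom, hScard⟩ := exists_conn_of_dominating hU m L hm
    (fun X hX => ⟨(hL X hX).1, fun x hx => by
      simpa using mem_linkedSeed_of_mem_seed hM hd hG ((hL X hX).2 x hx)⟩)
    (fun u hu => hLdom u ((mem_linkedSeed _ _ _ _).1 (by simpa using hu)).1)
  exact ⟨hU, S, hSU, hS, hSdom, m, hms, by omega⟩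

/-- The number of vertices of the linked seed. -/
theorem length_linkedSeed_le (hM : IsAdjMatrix M G) (hd : 1 ≤ d) (hG : NoBiclique d G) {B c : ℕ}
    (hB : B = 2 * d * (2 * k + 1) ^ d) (hc : c = 1 + (B + (B + 1) ^ d + d * B ^ d)) :
    (linkedSeed d s M k).length ≤ (B + (2 * s) ^ 2 * c ^ (2 * s)) +
      2 * (B + (2 * s) ^ 2 * c ^ (2 * s)) ^ 2 := by
  obtain ⟨-, -, hZ, -⟩ := core_spec hM hd (by omega : 1 ≤ 2 * k + 1) hG le_rfl
  have hseed : (seed d s M k).length ≤ B + (2 * s) ^ 2 * c ^ (2 * s) := by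
    rw [seed, List.length_append, ← hB] at *
    set Z := core M d (2 * k + 1) B
    gcongr
    have h1 : ((pieces M Z (2 * s)).flatMap fun X => X).length ≤
        (pieces M Z (2 * s)).length * (2 * s) := by
      rw [List.length_flatMap, ← smul_eq_mul]
      refine (List.sum_le_card_nsmul _ (2 * s) fun x hx => ?_).trans (by simp)
      obtain ⟨X, hX, rfl⟩ := List.mem_map.1 hx
      exact (mem_pieces hM Z _ X hX).2.2
    have h2 : (traces M Z).card.succ ≤ c := by
      have := card_traces_le hM hG Z
      have h3 : (Z.length + 1) ^ d ≤ (B + 1) ^ d := by gcongr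
      have h4 : d * Z.length ^ d ≤ d * B ^ d := by gcongr
      omega
    calc _ ≤ (2 * s * (traces M Z).card.succ ^ (2 * s)) * (2 * s) :=
          h1.trans (Nat.mul_le_mul_right _ (length_pieces_le Z (2 * s)))
      _ ≤ (2 * s * c ^ (2 * s)) * (2 * s) := by gcongr
      _ = _ := by ring
  have hlen : (linkedSeed d s M k).length ≤
      (seed d s M k ++ links M (seed d s M k)).length := by
    refine ((nodup_linkedSeed d s k).subperm fun v hv => ?_).length_le
    rw [mem_linkedSeed] at hv
    exact List.mem_append.2 hv.2
  rw [List.length_append] at hlen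
  have h1 := length_links_le hM (seed d s M k)
  have h2 : (seed d s M k).length ^ 2 ≤ (B + (2 * s) ^ 2 * c ^ (2 * s)) ^ 2 := by gcongr
  omega

theorem fallback_cases (hM : IsAdjMatrix M G) : (verts M = [] ∧ fallback M = []) ∨
    ∃ v ∈ verts M, fallback M = [v] ∧
      ((∃ u ∈ verts M, ∀ w ∈ verts M, Near G u w) → ∀ w ∈ verts M, Near G v w) := by
  unfold fallback
  set F := (verts M).filter fun v => (verts M).all fun w => near M v w with hF
  have hmem : ∀ v, v ∈ F ↔ v ∈ verts M ∧ ∀ w ∈ verts M, Near G v w := by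
    intro v
    simp [hF, List.mem_filter, hM.near_iff]
  cases hFl : F with
  | cons v l =>
    obtain ⟨h1, h2⟩ := (hmem v).1 (by simp [hFl])
    exact .inr ⟨v, h1, by simp, fun _ => h2⟩
  | nil =>
    cases hV : verts M with
    | nil => exact .inl ⟨rfl, by simp⟩
    | cons v l =>
      refine .inr ⟨v, by simp, by simp, ?_⟩
      rintro ⟨u, hu, h⟩
      have := (hmem u).2 ⟨by rwa [hV], by rwa [hV]⟩
      simp [hFl] at this

theorem kernelVerts_cases (hM : IsAdjMatrix M G) (d s k : ℕ) :
    (2 ≤ k ∧ Conn G (linkedSeed d s M k).toFinset ∧ kernelVerts d s M k = linkedSeed d s M k) ∨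
      (¬(2 ≤ k ∧ Conn G (linkedSeed d s M k).toFinset) ∧ kernelVerts d s M k = fallback M) := by
  unfold kernelVerts
  rw [← connected_iff hM]
  cases h : connected M (linkedSeed d s M k) <;> by_cases h2 : 2 ≤ k <;> simp [h2]

theorem nodup_kernelVerts (hM : IsAdjMatrix M G) (d s k : ℕ) : (kernelVerts d s M k).Nodup := by
  rcases kernelVerts_cases hM d s k with ⟨-, -, h⟩ | ⟨-, h⟩ <;> rw [h]
  · exact nodup_linkedSeed d s k
  · rcases fallback_cases hM with ⟨-, h⟩ | ⟨v, -, h, -⟩ <;> simp [h]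

theorem mem_verts_of_mem_kernelVerts (hM : IsAdjMatrix M G) {v : ℕ}
    (hv : v ∈ kernelVerts d s M k) : v ∈ verts M := by
  rcases kernelVerts_cases hM d s k with ⟨-, -, h⟩ | ⟨-, h⟩ <;> rw [h] at hv
  · exact ((mem_linkedSeed _ _ _ _).1 hv).1
  · rcases fallback_cases hM with ⟨-, h⟩ | ⟨u, hu, h, -⟩
    · simp [h] at hv
    · simp [h] at hv
      rwa [hv]

end Kernel

/-! ### Instances as matrices -/

open Classical in
/-- The adjacency matrix of a graph. -/
noncomputable def matrix {n : ℕ} (G : SimpleGraph (Fin n)) : List (List Bool) :=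
  List.ofFn fun i => List.ofFn fun j => decide (G.Adj i j)

/-- A graph on `0, …, n - 1`, extended to all natural numbers by isolated vertices. -/
def natGraph {n : ℕ} (G : SimpleGraph (Fin n)) : SimpleGraph ℕ where
  Adj u v := ∃ (hu : u < n) (hv : v < n), G.Adj ⟨u, hu⟩ ⟨v, hv⟩
  symm := ⟨fun _ _ ⟨hu, hv, h⟩ => ⟨hv, hu, h.symm⟩⟩
  loopless := ⟨fun _ ⟨_, _, h⟩ => G.loopless.irrefl _ h⟩

theorem comap_natGraph {n : ℕ} (G : SimpleGraph (Fin n)) :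
    (natGraph G).comap Fin.valEmbedding = G := by
  ext u v
  simp [natGraph]

theorem mem_verts_matrix {n : ℕ} (G : SimpleGraph (Fin n)) (v : ℕ) :
    v ∈ verts (matrix G) ↔ v < n := by
  simp [verts, matrix]

theorem isAdjMatrix_matrix {n : ℕ} (G : SimpleGraph (Fin n)) :
    IsAdjMatrix (matrix G) (natGraph G) := by
  classical
  intro u v
  simp only [adj, natGraph]
  by_cases hu : u < n
  · have hrow : (matrix G).getD u [] = List.ofFn fun j => decide (G.Adj ⟨u, hu⟩ j) := by
      simp [matrix, hu]
    rw [hrow]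
    by_cases hv : v < n <;> simp [hu, hv]
  · have hrow : (matrix G).getD u [] = [] := by simp [matrix, hu]
    rw [hrow]
    simp [hu]

theorem noBiclique_natGraph {n d : ℕ} (hd : 1 ≤ d) {G : SimpleGraph (Fin n)}
    (hG : bicliqueFree d n G) : NoBiclique d (natGraph G) := by
  intro A B hA hB h
  refine hG ?_
  have hlt : ∀ u v, (natGraph G).Adj u v → u < n := fun _ _ h => h.1
  obtain ⟨a₀, ha₀⟩ := Finset.card_pos.1 (by omega : 0 < A.card)
  obtain ⟨b₀, hb₀⟩ := Finset.card_pos.1 (by omega : 0 < B.card)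
  let eA := (A.equivFinOfCardEq hA).symm
  let eB := (B.equivFinOfCardEq hB).symm
  let f : Fin d ⊕ Fin d → Fin n := Sum.elim
    (fun i => ⟨eA i, hlt _ b₀ (h _ (eA i).2 _ hb₀)⟩)
    (fun j => ⟨eB j, hlt _ a₀ (h _ ha₀ _ (eB j).2).symm⟩)
  have hadj : ∀ i j, G.Adj (f (.inl i)) (f (.inr j)) := by
    intro i j
    exact (h _ (eA i).2 _ (eB j).2).2.2
  refine ⟨⟨⟨f, ?_⟩, ?_⟩⟩
  · rintro (i | i) (j | j) hij
    · simp at hij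
    · exact hadj i j
    · exact (hadj j i).symm
    · simp at hij
  · rintro (i | i) (j | j) hij
    · have : (eA i : ℕ) = eA j := congrArg Fin.val hij
      rw [eA.injective (Subtype.ext this)]
    · exact absurd hij (hadj i j).ne
    · exact absurd hij (hadj j i).ne'
    · have : (eB i : ℕ) = eB j := congrArg Fin.val hij
      rw [eB.injective (Subtype.ext this)]

theorem bicliqueFree_comap {n d : ℕ} {H : SimpleGraph ℕ} (hH : NoBiclique d H) (f : Fin n ↪ ℕ) :
    bicliqueFree d n (H.comap f) := by
  rintro ⟨φ⟩
  have hinj : Function.Injective fun x => f (φ x) := f.injective.comp φ.injective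
  refine hH (Finset.univ.image fun i : Fin d => f (φ (.inl i)))
    (Finset.univ.image fun i : Fin d => f (φ (.inr i))) ?_ ?_ ?_
  · exact (Finset.card_image_of_injective _ (hinj.comp Sum.inl_injective)).trans (by simp)
  · exact (Finset.card_image_of_injective _ (hinj.comp Sum.inr_injective)).trans (by simp)
  · intro a ha b hb
    simp only [Finset.mem_image, Finset.mem_univ, true_and] at ha hb
    obtain ⟨i, rfl⟩ := ha
    obtain ⟨j, rfl⟩ := hb
    exact φ.toHom.map_adj (by simp : (completeBipartiteGraph (Fin d) (Fin d)).Adj (.inl i) (.inr j))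

theorem conn_comap {n : ℕ} {H : SimpleGraph ℕ} (f : Fin n ↪ ℕ) (S : Finset (Fin n)) :
    Conn (H.comap f) S ↔ Conn H (S.map f) := by
  rw [conn_iff_cut, conn_iff_cut, Finset.map_nonempty]
  refine and_congr_right fun _ => ⟨fun h A => ?_, fun h A => ?_⟩
  · simpa using h (f ⁻¹' A)
  · simpa [-Set.mem_image, f.injective.mem_set_image] using h (f '' A)

/-- The connected dominating sets of a graph that is pulled back from the natural numbers. -/
theorem connectedDominatingSet_comap {n : ℕ} {H : SimpleGraph ℕ} (f : Fin n ↪ ℕ)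
    (S : Finset (Fin n)) : connectedDominatingSet n (H.comap f) S ↔
      Conn H (S.map f) ∧ Dominates H (S.map f) (Finset.univ.map f) := by
  rw [← conn_comap]
  refine and_congr_right fun _ => ?_
  simp only [Dominates, Finset.mem_map, Finset.mem_univ, true_and, forall_exists_index,
    forall_apply_eq_imp_iff, exists_exists_and_eq_and]
  refine forall_congr' fun v => ⟨?_, ?_⟩
  · rintro (h | ⟨u, hu, h⟩)
    · exact ⟨v, h, .refl _⟩
    · exact ⟨u, hu, .inr h.symm⟩
  · rintro ⟨u, hu, h | h⟩
    · exact .inl (f.injective h ▸ hu)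
    · exact .inr ⟨u, hu, h.symm⟩

theorem connectedDominatingSet_iff {n : ℕ} (G : SimpleGraph (Fin n)) (S : Finset (Fin n)) :
    connectedDominatingSet n G S ↔ Conn (natGraph G) (S.map Fin.valEmbedding) ∧
      Dominates (natGraph G) (S.map Fin.valEmbedding) (verts (matrix G)).toFinset := by
  have h : (verts (matrix G)).toFinset = (Finset.univ : Finset (Fin n)).map Fin.valEmbedding := by
    ext v
    rw [List.mem_toFinset, mem_verts_matrix]
    simp only [Finset.mem_map, Finset.mem_univ, true_and, Fin.valEmbedding_apply]
    exact ⟨fun h => ⟨⟨v, h⟩, rfl⟩, fun ⟨i, h⟩ => h ▸ i.2⟩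
  rw [h, ← connectedDominatingSet_comap]
  exact iff_of_eq (congrArg (connectedDominatingSet n · S) (comap_natGraph G).symm)

theorem encode_eq (I : Instance) : I.encode = enc (matrix I.graph, I.k) := by
  have h (l : List Bool) : enc l = Data.ofList (l.map Data.ofBool) := rfl
  change _ = Data.node (Data.ofList ((matrix I.graph).map enc)) (Data.ofNat I.k)
  simp only [Instance.encode, matrix, List.map_ofFn, Function.comp_def, h]

open Classical in
theorem encodeSet_eq {n : ℕ} (S : Finset (Fin n)) :
    encodeSet S = enc (List.ofFn fun i => decide (i ∈ S)) := by
  simp only [encodeSet, enc, List.map_ofFn]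
  rfl

/-! ### The reduction and the lifting of solutions -/

/-- The vertices of the kernel of an instance. -/
noncomputable def kverts (d s : ℕ) (I : Instance) : List ℕ := kernelVerts d s (matrix I.graph) I.k

theorem nodup_kverts (d s : ℕ) (I : Instance) : (kverts d s I).Nodup :=
  nodup_kernelVerts (isAdjMatrix_matrix _) d s _

/-- The kernel: an induced subgraph with the old parameter. -/
noncomputable def kernel (d s : ℕ) (I : Instance) : Instance where
  n := (kverts d s I).length
  graph := (natGraph I.graph).comap (kverts d s I).get
  k := I.k

/-- The vertices of the kernel as vertices of the given graph. -/
noncomputable def kernelEmbedding (d s : ℕ) (I : Instance) : Fin (kernel d s I).n ↪ ℕ :=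
  ⟨(kverts d s I).get, List.nodup_iff_injective_get.1 (nodup_kverts d s I)⟩

theorem exists_kernelEmbedding {d s : ℕ} {I : Instance} {v : ℕ} (hv : v ∈ kverts d s I) :
    ∃ i, kernelEmbedding d s I i = v := List.mem_iff_get.1 hv

theorem kernelEmbedding_mem (d s : ℕ) (I : Instance) (i : Fin (kernel d s I).n) :
    kernelEmbedding d s I i ∈ kverts d s I := List.get_mem _ _

theorem map_univ_kernelEmbedding (d s : ℕ) (I : Instance) :
    Finset.univ.map (kernelEmbedding d s I) = (kverts d s I).toFinset := by
  ext v
  simp only [Finset.mem_map, Finset.mem_univ, true_and, List.mem_toFinset]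
  exact ⟨fun ⟨i, h⟩ => h ▸ kernelEmbedding_mem d s I i, exists_kernelEmbedding⟩

theorem kernelEmbedding_lt {d s : ℕ} {I : Instance} (i : Fin (kernel d s I).n) :
    kernelEmbedding d s I i < I.n :=
  (mem_verts_matrix I.graph _).1 (mem_verts_of_mem_kernelVerts (isAdjMatrix_matrix _)
    (kernelEmbedding_mem d s I i))

theorem bicliqueFree_kernel {d : ℕ} (s : ℕ) (hd : 1 ≤ d) {I : Instance}
    (hI : bicliqueFree d I.n I.graph) :
    bicliqueFree d (kernel d s I).n (kernel d s I).graph :=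
  bicliqueFree_comap (noBiclique_natGraph hd hI) (kernelEmbedding d s I)

theorem matrix_kernel (d s : ℕ) (I : Instance) :
    matrix (kernel d s I).graph = submatrix (matrix I.graph) (kverts d s I) := by
  classical
  have h : ∀ i j, (kernel d s I).graph.Adj i j ↔
      adj (matrix I.graph) (kernelEmbedding d s I i) (kernelEmbedding d s I j) = true :=
    fun i j => (isAdjMatrix_matrix I.graph _ _).symm
  have hmap : ∀ (l : List ℕ) (β : Type) (g : ℕ → β), l.map g = List.ofFn fun i => g (l.get i) := by
    intro l β g
    refine List.ext_getElem (by simp) fun i h1 h2 => by simp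
  rw [matrix, submatrix, hmap]
  congr 1
  funext i
  rw [hmap]
  congr 1
  funext j
  rw [Bool.eq_iff_iff, decide_eq_true_eq]
  exact h i j

/-- The embedding of the kernel into the given graph. -/
noncomputable def liftEmbedding (d s : ℕ) (I : Instance) : Fin (kernel d s I).n ↪ Fin I.n :=
  ⟨fun i => ⟨kernelEmbedding d s I i, kernelEmbedding_lt i⟩,
    fun _ _ h => (kernelEmbedding d s I).injective (congrArg Fin.val h)⟩

open Classical in
/-- Solutions are lifted as they are; if the result is no connected dominating set, then the set of all
vertices is taken instead. -/
noncomputable def liftSolution (d s : ℕ) (I : Instance) (S : Finset (Fin (kernel d s I).n)) :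
    Finset (Fin I.n) :=
  if connectedDominatingSet I.n I.graph (S.map (liftEmbedding d s I)) then
    S.map (liftEmbedding d s I)
  else Finset.univ

/-- A graph that is dominated by a connected set is connected. -/
theorem Conn.of_dominates {V : Type} {G : SimpleGraph V} {D W : Finset V} (hD : Conn G D)
    (hDW : D ⊆ W) (hdom : Dominates G D W) : Conn G W := by
  refine conn_iff_cut.2 ⟨hD.nonempty.mono hDW, ?_⟩
  rintro A ⟨a, ha, haA⟩ ⟨b, hb, hbA⟩
  obtain ⟨x, hx, hxa⟩ := hdom a ha
  obtain ⟨y, hy, hyb⟩ := hdom b hb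
  by_cases hxA : x ∈ A
  · by_cases hyA : y ∈ A
    · rcases hyb with rfl | h
      · exact absurd hyA hbA
      · exact ⟨y, hDW hy, b, hb, hyA, hbA, h⟩
    · obtain ⟨p, hp, q, hq, h⟩ := hD.cut A hx hxA hy hyA
      exact ⟨p, hDW hp, q, hDW hq, h⟩
  · rcases hxa with rfl | h
    · exact absurd haA hxA
    · exact ⟨a, ha, x, hDW hx, haA, hxA, h.symm⟩

section Lift

variable {d s : ℕ} {I : Instance}

theorem mem_selected {U : List ℕ} (S : Finset (Fin U.length)) [DecidablePred (· ∈ S)] (v : ℕ) :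
    v ∈ selected U (List.ofFn fun i => decide (i ∈ S)) ↔ ∃ i ∈ S, U.get i = v := by
  simp only [selected, List.mem_map, List.mem_filter, List.mem_range]
  constructor
  · rintro ⟨i, ⟨hi, h⟩, rfl⟩
    refine ⟨⟨i, hi⟩, by simpa [hi] using h, ?_⟩
    simp [hi]
  · rintro ⟨i, hi, rfl⟩
    exact ⟨i, ⟨i.2, by simpa using hi⟩, by simp⟩

theorem connectedDominatingSet_lift_iff (S : Finset (Fin (kernel d s I).n)) :
    connectedDominatingSet I.n I.graph (S.map (liftEmbedding d s I)) ↔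
    Conn (natGraph I.graph) (S.map (kernelEmbedding d s I)) ∧
      Dominates (natGraph I.graph) (S.map (kernelEmbedding d s I))
        (verts (matrix I.graph)).toFinset := by
  rw [connectedDominatingSet_iff, Finset.map_map]
  rfl

/-- The lifting of solutions is what `solutionBits` computes. -/
theorem encodeSet_liftSolution (S : Finset (Fin (kernel d s I).n)) [DecidablePred (· ∈ S)] :
    encodeSet (liftSolution d s I S) = enc (solutionBits (matrix I.graph)
      (selected (kverts d s I) (List.ofFn fun i => decide (i ∈ S)))) := by
  classical
  have hM := isAdjMatrix_matrix I.graph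
  rw [encodeSet_eq]
  congr 1
  have hmem : ∀ v, v ∈ selected (kverts d s I) (List.ofFn fun i => decide (i ∈ S)) ↔
      v ∈ S.map (kernelEmbedding d s I) := by
    intro v
    rw [Finset.mem_map]
    exact @mem_selected (kverts d s I) S ‹_› v
  set L := selected (kverts d s I) (List.ofFn fun i => decide (i ∈ S)) with hL
  have hLS : L.toFinset = S.map (kernelEmbedding d s I) := by
    ext v
    rw [List.mem_toFinset, hmem]
  have hverts : ∀ f : ℕ → Bool, (verts (matrix I.graph)).map f = List.ofFn fun i : Fin I.n => f i := by
    intro f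
    refine List.ext_getElem (by simp [verts, matrix]) fun i h1 h2 => by simp [verts]
  have htest : (connected (matrix I.graph) L && (verts (matrix I.graph)).all fun v =>
      dominates (matrix I.graph) L v) = true ↔ Conn (natGraph I.graph) (S.map (kernelEmbedding d s I)) ∧
      Dominates (natGraph I.graph) (S.map (kernelEmbedding d s I))
        (verts (matrix I.graph)).toFinset := by
    rw [Bool.and_eq_true, connected_iff hM, hLS, List.all_eq_true]
    refine and_congr_right fun _ => ?_
    simp only [Dominates, List.mem_toFinset, hM.dominates_iff, hmem]
  unfold solutionBits liftSolution
  rw [hverts, hverts, Bool.cond_eq_ite]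
  simp only [htest, connectedDominatingSet_lift_iff]
  split_ifs
  · congr 1
    funext i
    rw [Bool.eq_iff_iff]
    simp only [decide_eq_true_eq, List.contains_eq_mem, hmem, Finset.mem_map, Fin.ext_iff]
    rfl
  · simp

theorem opt_kernel_le {S : Finset ℕ} (hS : S ⊆ (kverts d s I).toFinset)
    (hconn : Conn (natGraph I.graph) S)
    (hdom : Dominates (natGraph I.graph) S (kverts d s I).toFinset) :
    opt connectedDominatingSet (kernel d s I) ≤ ((min S.card (I.k + 1) : ℕ) : ℝ≥0∞) := by
  classical
  obtain ⟨T, rfl⟩ : ∃ T : Finset (Fin (kernel d s I).n), T.map (kernelEmbedding d s I) = S := by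
    rw [← map_univ_kernelEmbedding, Finset.subset_map_iff] at hS
    obtain ⟨T, -, h⟩ := hS
    exact ⟨T, h.symm⟩
  refine (iInf_le _ T).trans ?_
  rw [value, if_pos, Finset.card_map]
  · rfl
  · exact (connectedDominatingSet_comap (kernelEmbedding d s I) T).2
      ⟨hconn, by rwa [map_univ_kernelEmbedding]⟩

/-- The optimum value grows at most by the factor `1 + 3 / s`. -/
theorem opt_kernel_le_mul (hd : 1 ≤ d) (hs : 1 ≤ s) (hI : bicliqueFree d I.n I.graph)
    {D : Finset (Fin I.n)} (hD : connectedDominatingSet I.n I.graph D) :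
    opt connectedDominatingSet (kernel d s I) ≤
      ENNReal.ofReal (1 + 3 / s) * value connectedDominatingSet I D := by
  classical
  have hM := isAdjMatrix_matrix I.graph
  have hG := noBiclique_natGraph hd hI
  rw [value, if_pos hD]
  rw [connectedDominatingSet_iff] at hD
  obtain ⟨hDc, hDd⟩ := hD
  rw [← Finset.card_map Fin.valEmbedding]
  have hDv : ∀ v ∈ D.map Fin.valEmbedding, v ∈ verts (matrix I.graph) := by
    intro v hv
    obtain ⟨i, -, rfl⟩ := Finset.mem_map.1 hv
    exact (mem_verts_matrix _ _).2 i.2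
  generalize D.map Fin.valEmbedding = D at hDc hDd hDv ⊢
  have hW := hDc.of_dominates (fun v hv => by simpa using hDv v hv) hDd
  have hDpos := Finset.card_pos.2 hDc.nonempty
  have hs0 : (0 : ℝ) ≤ 3 / s := by positivity
  have hone : (1 : ℝ≥0∞) ≤ ENNReal.ofReal (1 + 3 / s) := by
    rw [ENNReal.one_le_ofReal]
    linarith
  -- if the optimum does not grow at all, the factor is not needed
  have hdirect : ∀ m : ℕ, opt connectedDominatingSet (kernel d s I) ≤ (m : ℝ≥0∞) →
      m ≤ min D.card (I.k + 1) → opt connectedDominatingSet (kernel d s I) ≤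
      ENNReal.ofReal (1 + 3 / s) * ((min D.card (I.k + 1) : ℕ) : ℝ≥0∞) := by
    intro m h hm
    refine h.trans ((Nat.cast_le.2 hm).trans ?_)
    exact le_mul_of_one_le_left zero_le hone
  rcases kernelVerts_cases hM d s I.k with ⟨hk, hU, h⟩ | ⟨-, h⟩
  · have hkv : kverts d s I = linkedSeed d s (matrix I.graph) I.k := h
    rcases Nat.lt_or_ge I.k D.card with hlt | hle
    · refine hdirect _ (opt_kernel_le (S := (kverts d s I).toFinset) (by rfl) (by rwa [hkv])
        fun v hv => ⟨v, hv, .refl v⟩) ?_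
      omega
    · obtain ⟨-, S, hSU, hSc, hSd, m, hm, hcard⟩ :=
        exists_conn_dominating_linkedSeed hM hd hs hG hW hDv hDc hDd hle
      rw [← hkv] at hSU hSd
      refine (opt_kernel_le hSU hSc hSd).trans ?_
      have hmin : min D.card (I.k + 1) = D.card := by omega
      rw [hmin, ← ENNReal.ofReal_natCast, ← ENNReal.ofReal_natCast,
        ← ENNReal.ofReal_mul (by linarith)]
      refine ENNReal.ofReal_le_ofReal ?_
      have h1 : ((min S.card (I.k + 1) : ℕ) : ℝ) ≤ D.card + 3 * m := by
        have : min S.card (I.k + 1) ≤ D.card + 3 * m := by omega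
        exact_mod_cast this
      have h2 : (m : ℝ) * s ≤ D.card := by exact_mod_cast hm
      have hspos : (0 : ℝ) < s := by exact_mod_cast hs
      have h3 : (m : ℝ) ≤ D.card / s := (le_div_iff₀ hspos).2 h2
      calc _ ≤ _ := h1
        _ ≤ D.card + 3 * (D.card / s) := by linarith
        _ = _ := by ring
  · rcases fallback_cases hM with ⟨h', -⟩ | ⟨v, -, h', -⟩
    · obtain ⟨w, hw⟩ := hDc.nonempty
      have := hDv w hw
      simp [h'] at this
    · have hkv : kverts d s I = [v] := h.trans h'
      refine hdirect _ (opt_kernel_le (S := {v}) (by simp [hkv]) (conn_singleton v) fun w hw => ?_) ?_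
      · exact ⟨v, by simp, .inl (by simpa [hkv, eq_comm] using hw)⟩
      · rw [Finset.card_singleton]
        omega

/-- A lifted solution is not worse than the given one, unless the instance has no connected
dominating set of at most `k` vertices. -/
theorem value_liftSolution_le (hd : 1 ≤ d) (hs : 1 ≤ s) (hI : bicliqueFree d I.n I.graph)
    {S : Finset (Fin (kernel d s I).n)}
    (hS : connectedDominatingSet (kernel d s I).n (kernel d s I).graph S) {D : Finset (Fin I.n)}
    (hD : connectedDominatingSet I.n I.graph D) :
    value connectedDominatingSet I (liftSolution d s I S) ≤
        value connectedDominatingSet (kernel d s I) S ∨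
      value connectedDominatingSet I (liftSolution d s I S) ≤ value connectedDominatingSet I D := by
  classical
  have hM := isAdjMatrix_matrix I.graph
  have hG := noBiclique_natGraph hd hI
  have hvS : value connectedDominatingSet (kernel d s I) S =
      ((min S.card (I.k + 1) : ℕ) : ℝ≥0∞) := by rw [value, if_pos hS]; rfl
  have hvD : value connectedDominatingSet I D =
      ((min D.card (I.k + 1) : ℕ) : ℝ≥0∞) := by rw [value, if_pos hD]
  have hS' := (connectedDominatingSet_comap (kernelEmbedding d s I) S).1 hS
  rw [map_univ_kernelEmbedding] at hS'
  obtain ⟨hSc, hSd⟩ := hS'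
  rw [connectedDominatingSet_iff] at hD
  obtain ⟨hDc, hDd⟩ := hD
  have hDv : ∀ v ∈ D.map Fin.valEmbedding, v ∈ verts (matrix I.graph) := by
    intro v hv
    obtain ⟨i, -, rfl⟩ := Finset.mem_map.1 hv
    exact (mem_verts_matrix _ _).2 i.2
  have hW := hDc.of_dominates (fun v hv => by simpa using hDv v hv) hDd
  rw [hvS, hvD]
  unfold liftSolution
  rw [connectedDominatingSet_lift_iff]
  split_ifs with hlift
  · left
    rw [value, if_pos ((connectedDominatingSet_lift_iff S).2 hlift), Finset.card_map]
  have huniv : value connectedDominatingSet I Finset.univ ≤ ((I.k + 1 : ℕ) : ℝ≥0∞) := by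
    rw [value, if_pos]
    · exact Nat.cast_le.2 (min_le_right _ _)
    · have huv : (Finset.univ : Finset (Fin I.n)).map Fin.valEmbedding =
          (verts (matrix I.graph)).toFinset := by
        ext v
        rw [List.mem_toFinset, mem_verts_matrix]
        simp only [Finset.mem_map, Finset.mem_univ, true_and, Fin.valEmbedding_apply]
        exact ⟨fun ⟨i, h⟩ => h ▸ i.2, fun h => ⟨⟨v, h⟩, rfl⟩⟩
      rw [connectedDominatingSet_iff, huv]
      exact ⟨hW, fun v hv => ⟨v, hv, .refl v⟩⟩
  rcases kernelVerts_cases hM d s I.k with ⟨hk, hU, h⟩ | ⟨hno, h⟩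
  · left
    have hkv : kverts d s I = linkedSeed d s (matrix I.graph) I.k := h
    rcases Nat.lt_or_ge I.k S.card with hlt | hle
    · rwa [min_eq_right (by omega)]
    · refine absurd ⟨hSc, ?_⟩ hlift
      refine dominates_verts_of_dominates_linkedSeed hM hd hG (k := I.k) (s := s) ?_ ?_
        (by rwa [← hkv])
      · intro v hv
        obtain ⟨i, -, rfl⟩ := Finset.mem_map.1 hv
        exact mem_verts_of_mem_kernelVerts hM (kernelEmbedding_mem d s I i)
      · rw [Finset.card_map]
        omega
  -- the kernel is a single vertex that does not dominate the graph; this is possible only if every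
  -- connected dominating set has more than `k` elements
  · right
    suffices I.k < D.card by rwa [min_eq_right (by omega)]
    by_contra hle
    rw [← Finset.card_map Fin.valEmbedding] at hle
    generalize D.map Fin.valEmbedding = D at hDc hDd hDv hle
    by_cases hk : 2 ≤ I.k
    · exact hno ⟨hk, (exists_conn_dominating_linkedSeed hM hd hs hG hW hDv hDc hDd
        (by omega)).1⟩
    · have := Finset.card_pos.2 hDc.nonempty
      obtain ⟨u, rfl⟩ := Finset.card_eq_one.1 (by omega : D.card = 1)
      rcases fallback_cases hM with ⟨h', -⟩ | ⟨v, -, h', hv⟩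
      · have := hDv u (by simp)
        simp [h'] at this
      · have hkv : kverts d s I = [v] := h.trans h'
        obtain ⟨w, hw⟩ := hSc.nonempty
        have hwv : w = v := by
          obtain ⟨i, -, rfl⟩ := Finset.mem_map.1 hw
          simpa [hkv] using kernelEmbedding_mem d s I i
        rw [hwv] at hw
        refine hlift ⟨hSc, fun y hy => ⟨v, hw, hv ⟨u, hDv u (by simp), fun w hw => ?_⟩ y
          (by simpa using hy)⟩⟩
        simpa using hDd w (by simpa using hw)

/-- The approximation guarantee. -/
theorem ratio_liftSolution_le (hd : 1 ≤ d) (hs : 1 ≤ s) (hI : bicliqueFree d I.n I.graph)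
    (S : Finset (Fin (kernel d s I).n)) {α : ℝ} (hα : 1 + 3 / s ≤ α) :
    value connectedDominatingSet I (liftSolution d s I S) / opt connectedDominatingSet I ≤
      ENNReal.ofReal α * (value connectedDominatingSet (kernel d s I) S /
        opt connectedDominatingSet (kernel d s I)) := by
  classical
  have hs0 : (0 : ℝ) ≤ 3 / s := by positivity
  have hone : (1 : ℝ≥0∞) ≤ ENNReal.ofReal α := by
    rw [ENNReal.one_le_ofReal]
    linarith
  obtain ⟨D, hDopt⟩ := Finite.exists_min (value connectedDominatingSet I)
  have hoptD : opt connectedDominatingSet I = value connectedDominatingSet I D :=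
    le_antisymm (iInf_le _ D) (le_iInf hDopt)
  by_cases hD : connectedDominatingSet I.n I.graph D
  swap
  · rw [hoptD, value, value, if_neg hD]
    simp
  have hpos : ∀ (J : Instance) (T : Finset (Fin J.n)), 1 ≤ value connectedDominatingSet J T := by
    intro J T
    rw [value]
    split_ifs with h
    · have : T.Nonempty := Conn.nonempty h.1
      have := Finset.card_pos.2 this
      exact_mod_cast (by omega : 1 ≤ min T.card (J.k + 1))
    · exact le_top
  have hfin : value connectedDominatingSet I D ≠ ∞ := by
    rw [value, if_pos hD]
    exact ENNReal.natCast_ne_top _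
  have hopt := (opt_kernel_le_mul hd hs hI hD).trans
    (mul_le_mul_left (ENNReal.ofReal_le_ofReal hα) _)
  have hopt'fin : opt connectedDominatingSet (kernel d s I) ≠ ∞ :=
    (hopt.trans_lt (ENNReal.mul_lt_top ENNReal.ofReal_lt_top hfin.lt_top)).ne
  have hopt'pos : opt connectedDominatingSet (kernel d s I) ≠ 0 :=
    (lt_of_lt_of_le one_pos (le_iInf fun T => hpos _ T)).ne'
  by_cases hS : connectedDominatingSet (kernel d s I).n (kernel d s I).graph S
  swap
  · have : value connectedDominatingSet (kernel d s I) S = ∞ := by rw [value, if_neg hS]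
    rw [this, ENNReal.top_div_of_ne_top hopt'fin, ENNReal.mul_top (by positivity)]
    exact le_top
  rw [hoptD, ENNReal.div_le_iff (lt_of_lt_of_le one_pos (hpos _ _)).ne' hfin]
  set v := value connectedDominatingSet (kernel d s I) S with hv
  set o := opt connectedDominatingSet (kernel d s I) with ho
  set a := ENNReal.ofReal α with ha
  set w := value connectedDominatingSet I D with hw
  have hov : o ≤ v := iInf_le _ S
  have hcancel : v / o * o = v := ENNReal.div_mul_cancel hopt'pos hopt'fin
  rcases value_liftSolution_le hd hs hI hS hD with h | h
  · calc _ ≤ v := h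
      _ = v / o * o := hcancel.symm
      _ ≤ v / o * (a * w) := by gcongr
      _ = _ := by ring
  · calc _ ≤ w := h
      _ = 1 * 1 * w := by simp
      _ ≤ a * (v / o) * w := by
        gcongr
        rw [ENNReal.le_div_iff_mul_le (.inl hopt'pos) (.inl hopt'fin), one_mul]
        exact hov

end Lift

/-- The approximate kernel. -/
noncomputable def approxKernel {d s : ℕ} (hd : 1 ≤ d) (hs : 1 ≤ s) {α : ℝ} (hα : 1 + 3 / s ≤ α) :
    ApproxPreprocessing connectedDominatingSet (bicliqueFree d) α where
  reduce I := ⟨kernel d s I.1, bicliqueFree_kernel s hd I.2⟩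
  lift I S := liftSolution d s I.1 S
  reduce_polyTime := by
    have := (polyTime_reduce d s).reindex
      fun I : InstanceOn (bicliqueFree d) => (matrix I.1.graph, I.1.k)
    convert this using 2 with I I
    · exact encode_eq I.1
    · rw [encode_eq, matrix_kernel]
      rfl
  lift_polyTime := by
    classical
    have := (polyTime_lift d s).reindex
      fun i : (I : InstanceOn (bicliqueFree d)) × Finset (Fin (kernel d s I.1).n) =>
        ((matrix i.1.1.graph, i.1.1.k), (matrix (kernel d s i.1.1).graph, (kernel d s i.1.1).k),
          List.ofFn fun j => decide (j ∈ i.2))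
    convert this using 2 with i i
    · rw [encode_eq, encode_eq, encodeSet_eq]
      rfl
    · exact encodeSet_liftSolution i.2
  ratio_le I S := ratio_liftSolution_le hd hs I.2 S hα

/-! ### The size of the kernel -/

theorem two_mul_le_pow {k : ℕ} (hk : 2 ≤ k) (m : ℕ) : 2 * m ≤ k ^ m := by
  have h : 2 * m ≤ 2 ^ m := by
    induction m with
    | zero => simp
    | succ m ih =>
      rcases m with _ | m
      · simp
      · rw [pow_succ 2 (m + 1)]
        omega
  exact h.trans (Nat.pow_le_pow_left hk m)

/-- The bound on the number of vertices of the linked seed, as a power of `k`. -/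
theorem linkedSeed_bound {k d s : ℕ} (hk : 2 ≤ k) (hd : 1 ≤ d) (hs : 1 ≤ s) {B c : ℕ}
    (hB : B = 2 * d * (2 * k + 1) ^ d) (hc : c = 1 + (B + (B + 1) ^ d + d * B ^ d)) :
    (B + (2 * s) ^ 2 * c ^ (2 * s)) + 2 * (B + (2 * s) ^ 2 * c ^ (2 * s)) ^ 2 ≤
      k ^ (36 * d ^ 2 * s) := by
  have hk0 : 0 < k := by omega
  have mono : ∀ {a b : ℕ}, a ≤ b → k ^ a ≤ k ^ b := fun h => Nat.pow_le_pow_right hk0 h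
  have hdd : d ≤ d ^ 2 := Nat.le_self_pow (by omega) d
  have hds : d ^ 2 ≤ d ^ 2 * s := Nat.le_mul_of_pos_right _ hs
  have hB4 : B ≤ k ^ (4 * d) := by
    have h1 : 2 * k + 1 ≤ k ^ 3 := by nlinarith [Nat.mul_le_mul hk hk]
    calc B = 2 * d * (2 * k + 1) ^ d := hB
      _ ≤ k ^ d * (k ^ 3) ^ d := Nat.mul_le_mul (two_mul_le_pow hk d) (Nat.pow_le_pow_left h1 d)
      _ = k ^ (4 * d) := by rw [← pow_mul, ← pow_add]; congr 1; ring
  have double : ∀ {a x : ℕ}, x ≤ k ^ a → 2 * x ≤ k ^ (a + 1) := by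
    intro a x hx
    rw [pow_succ, mul_comm]
    exact Nat.mul_le_mul hx hk
  have hB1 : B + 1 ≤ k ^ (5 * d) := by
    have : 1 ≤ k ^ (4 * d) := Nat.one_le_pow _ _ hk0
    have h2 := double (le_refl (k ^ (4 * d)))
    have := mono (show 4 * d + 1 ≤ 5 * d by omega)
    omega
  have hBd : (B + 1) ^ d ≤ k ^ (5 * d ^ 2) := by
    calc (B + 1) ^ d ≤ (k ^ (5 * d)) ^ d := Nat.pow_le_pow_left hB1 d
      _ = k ^ (5 * d ^ 2) := by rw [← pow_mul]; congr 1; ring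
  have hdB : d * B ^ d ≤ k ^ (5 * d ^ 2) := by
    have h1 := two_mul_le_pow hk d
    calc d * B ^ d ≤ k ^ d * (k ^ (4 * d)) ^ d :=
          Nat.mul_le_mul (by omega) (Nat.pow_le_pow_left hB4 d)
      _ = k ^ (d + 4 * d ^ 2) := by rw [← pow_mul, ← pow_add]; congr 1; ring
      _ ≤ k ^ (5 * d ^ 2) := mono (by omega)
  have hcb : c ≤ k ^ (7 * d ^ 2) := by
    have h1 := mono (show 5 * d ≤ 5 * d ^ 2 by omega)
    have h2 := double (double (le_refl (k ^ (5 * d ^ 2))))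
    have h3 := mono (show 5 * d ^ 2 + 1 + 1 ≤ 7 * d ^ 2 by nlinarith)
    omega
  have hT : (2 * s) ^ 2 * c ^ (2 * s) ≤ k ^ (16 * (d ^ 2 * s)) := by
    calc (2 * s) ^ 2 * c ^ (2 * s) ≤ (k ^ s) ^ 2 * (k ^ (7 * d ^ 2)) ^ (2 * s) :=
          Nat.mul_le_mul (Nat.pow_le_pow_left (two_mul_le_pow hk s) 2)
            (Nat.pow_le_pow_left hcb _)
      _ = k ^ (2 * s + 14 * (d ^ 2 * s)) := by
          rw [← pow_mul, ← pow_mul, ← pow_add]; congr 1; ring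
      _ ≤ k ^ (16 * (d ^ 2 * s)) := mono (by nlinarith [Nat.one_le_pow 2 d hd])
  generalize (2 * s) ^ 2 * c ^ (2 * s) = T at hT ⊢
  have hpos : 1 ≤ d ^ 2 * s := Nat.mul_pos (by positivity) hs
  have hX : B + T ≤ k ^ (17 * (d ^ 2 * s)) := by
    have h1 := mono (show 4 * d ≤ 16 * (d ^ 2 * s) by omega)
    have h2 := double (le_refl (k ^ (16 * (d ^ 2 * s))))
    have h3 := mono (show 16 * (d ^ 2 * s) + 1 ≤ 17 * (d ^ 2 * s) by omega)
    omega
  have hX2 : (B + T) ^ 2 ≤ k ^ (34 * (d ^ 2 * s)) := by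
    calc (B + T) ^ 2 ≤ (k ^ (17 * (d ^ 2 * s))) ^ 2 := Nat.pow_le_pow_left hX 2
      _ = k ^ (34 * (d ^ 2 * s)) := by rw [← pow_mul]; congr 1; ring
  have h1 : B + T ≤ (B + T) ^ 2 := Nat.le_self_pow (by omega) _
  have h2 := double (double hX2)
  have h3 := mono (show 34 * (d ^ 2 * s) + 1 + 1 ≤ 36 * d ^ 2 * s by rw [mul_assoc]; omega)
  omega

theorem kernel_n_le {d s : ℕ} (hd : 1 ≤ d) (hs : 1 ≤ s) {I : Instance}
    (hI : bicliqueFree d I.n I.graph) : (kernel d s I).n ≤ max I.k 1 ^ (36 * d ^ 2 * s) := by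
  have hM := isAdjMatrix_matrix I.graph
  rcases kernelVerts_cases hM d s I.k with ⟨hk, -, h⟩ | ⟨-, h⟩
  · rw [max_eq_left (by omega)]
    change (kernelVerts d s (matrix I.graph) I.k).length ≤ _
    rw [h]
    exact (length_linkedSeed_le hM hd (noBiclique_natGraph hd hI) rfl rfl).trans
      (linkedSeed_bound hk hd hs rfl rfl)
  · have h1 : 1 ≤ max I.k 1 ^ (36 * d ^ 2 * s) := Nat.one_le_pow _ _ (by omega)
    refine le_trans ?_ h1
    change (kernelVerts d s (matrix I.graph) I.k).length ≤ _
    rw [h]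
    rcases fallback_cases hM with ⟨-, h⟩ | ⟨v, -, h, -⟩ <;> simp [h]

theorem esize_le_of_forall {α : Type} [Enc α] {N : ℕ} (l : List α) (h : ∀ a ∈ l, esize a ≤ N) :
    esize l ≤ l.length * (N + 1) + 1 := by
  induction l with
  | nil => simp
  | cons a l ih =>
    have h1 := ih fun x hx => h x (by simp [hx])
    have h2 := h a (by simp)
    rw [esize_cons, List.length_cons, add_mul, one_mul]
    omega

/-- The size of the code of an instance. -/
theorem size_encode_le (I : Instance) : I.encode.size ≤ I.n * (I.n * 4 + 2) + 2 * I.k + 3 := by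
  classical
  rw [encode_eq]
  change esize (matrix I.graph, I.k) ≤ _
  rw [esize_pair, esize_nat]
  have h := esize_le_of_forall (N := I.n * 4 + 1) (matrix I.graph) (by
    intro r hr
    obtain ⟨i, rfl⟩ := (List.mem_ofFn' _ _).1 hr
    exact (esize_le_of_forall _ fun b _ => esize_bool_le b).trans (by simp))
  have hlen : (matrix I.graph).length = I.n := by simp [matrix]
  rw [hlen, show I.n * 4 + 1 + 1 = I.n * 4 + 2 from rfl] at h
  omega

end LossyKernel

theorem theorem2 :
    (∃ C : ℝ, ∀ d : ℕ, 1 ≤ d → ∀ ε : ℝ, 0 < ε →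
      LossyKernel.HasApproxKernelWithVertices LossyKernel.connectedDominatingSet
        (LossyKernel.bicliqueFree d) (1 + ε)
        (fun k => ((max k 1 : ℕ) : ℝ) ^ (C * (d : ℝ) ^ 2 / min ε 1))) ∧
    (∀ d : ℕ, 1 ≤ d →
      LossyKernel.HasPSAKS LossyKernel.connectedDominatingSet (LossyKernel.bicliqueFree d)) := by
  -- `s = ⌈3 / ε⌉` makes the loss factor `1 + 3 / s` at most `1 + ε`
  have hceil : ∀ ε : ℝ, 0 < ε → 1 ≤ ⌈3 / ε⌉₊ ∧ 3 / (⌈3 / ε⌉₊ : ℝ) ≤ ε := by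
    intro ε hε
    have h1 : 0 < ⌈3 / ε⌉₊ := Nat.ceil_pos.2 (by positivity)
    refine ⟨h1, ?_⟩
    rw [div_le_iff₀ (by exact_mod_cast h1), mul_comm, ← div_le_iff₀ hε]
    exact Nat.le_ceil _
  constructor
  · refine ⟨144, fun d hd ε hε => ?_⟩
    have hε' : 0 < min ε 1 := lt_min hε one_pos
    obtain ⟨hs, hsε⟩ := hceil _ hε'
    set s := ⌈3 / min ε 1⌉₊ with hsdef
    have hd' : (1 : ℝ) ≤ (d : ℝ) ^ 2 := one_le_pow₀ (by exact_mod_cast hd)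
    have hs4 : (s : ℝ) ≤ 4 / min ε 1 := by
      have h1 := (Nat.ceil_lt_add_one (show 0 ≤ 3 / min ε 1 by positivity)).le
      have h2 : 1 ≤ 1 / min ε 1 := by rw [le_div_iff₀ hε']; simp
      have h3 : 4 / min ε 1 = 3 / min ε 1 + 1 / min ε 1 := by ring
      linarith
    have hexp : ((36 * d ^ 2 * s : ℕ) : ℝ) ≤ 144 * (d : ℝ) ^ 2 / min ε 1 := by
      push_cast
      calc (36 * (d : ℝ) ^ 2 * s) ≤ 36 * (d : ℝ) ^ 2 * (4 / min ε 1) := by gcongr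
        _ = _ := by ring
    have hpow : ∀ k : ℕ, ((max k 1 ^ (36 * d ^ 2 * s) : ℕ) : ℝ) ≤
        ((max k 1 : ℕ) : ℝ) ^ (144 * (d : ℝ) ^ 2 / min ε 1) := by
      intro k
      rw [Nat.cast_pow, ← Real.rpow_natCast]
      exact Real.rpow_le_rpow_of_exponent_le (by exact_mod_cast le_max_right k 1) hexp
    refine ⟨LossyKernel.approxKernel hd hs (by linarith [min_le_left ε 1]), fun I => ⟨?_, ?_⟩⟩
    · exact (Nat.cast_le.2 (LossyKernel.kernel_n_le hd hs I.2)).trans (hpow _)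
    · refine le_trans (Nat.cast_le.2 ?_) (hpow I.1.k)
      have : 36 * d ^ 2 * s ≠ 0 := by positivity
      exact (le_max_left I.1.k 1).trans (Nat.le_self_pow this _)
  · refine fun d hd => ⟨fun _ => 11, fun α => ((2 * (36 * d ^ 2 * ⌈3 / (α - 1)⌉₊) : ℕ) : ℝ),
      fun α hα => ?_⟩
    obtain ⟨hs, hsε⟩ := hceil (α - 1) (by linarith)
    set s := ⌈3 / (α - 1)⌉₊ with hsdef
    refine ⟨LossyKernel.approxKernel hd hs (by linarith), fun I => ?_⟩
    rw [Real.rpow_natCast]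
    have hn := LossyKernel.kernel_n_le hd hs I.2
    have hsize := LossyKernel.size_encode_le (LossyKernel.kernel d s I.1)
    have hk : I.1.k ≤ max I.1.k 1 ^ (36 * d ^ 2 * s) :=
      (le_max_left I.1.k 1).trans (Nat.le_self_pow (by positivity) _)
    have hone : 1 ≤ max I.1.k 1 ^ (36 * d ^ 2 * s) := Nat.one_le_pow _ _ (by omega)
    have hk' : (LossyKernel.kernel d s I.1).k = I.1.k := rfl
    have key : (LossyKernel.kernel d s I.1).encode.size ≤
        11 * max I.1.k 1 ^ (2 * (36 * d ^ 2 * s)) := by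
      rw [mul_comm 2, pow_mul]
      rw [hk'] at hsize
      generalize max I.1.k 1 ^ (36 * d ^ 2 * s) = x at *
      nlinarith
    have key' : ((LossyKernel.kernel d s I.1).encode.size : ℝ) ≤
        11 * ((max I.1.k 1 : ℕ) : ℝ) ^ (2 * (36 * d ^ 2 * s)) := by exact_mod_cast key
    exact key'
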